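/- **Theorem (eigenvector phase transition, multiplicative perturbation, rank one).** For each $n\ge 1$ let $X_n$ be an $n\times n$ real symmetric (or complex Hermitian) non-negative definite random matrix and $P_n$ an $n\times n$ real symmetric (respectively complex Hermitian) random matrix of rank one whose sole non-zero eigenvalue is $\theta$, where $\theta\neq 0$ is a real constant not depending on $n$. All matrices are defined on one probability space; for each $n$, $X_n$ and $P_n$ are independent and the law of at least one of them is invariant under conjugation by the orthogonal (respectively unitary) group. Assume that almost surely the empirical eigenvalue distribution $\frac1n\sum_{j}\delta_{\lambda_j(X_n)}$ converges weakly to a non-random compactly supported probability measure $\mu_X\neq\delta_0$, and that the smallest and largest eigenvalues of $X_n$ converge almost surely to $a:=\min\operatorname{supp}\mu_X$ and $b:=\max\operatorname{supp}\mu_X$. For real $z\notin[a,b]$ put $$T_{\mu_X}(z)=\int\frac{t}{z-t}\,\mathrm d\mu_X(t),$$ and let $T_{\mu_X}(a^-)=\lim_{z\uparrow a}T_{\mu_X}(z)\in[-\infty,0)$, $T_{\mu_X}(b^+)=\lim_{z\downarrow b}T_{\mu_X}(z)\in(0,+\infty]$, and likewise for the derivative $T'_{\mu_X}$. Suppose that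 $$\frac1\theta\notin\bigl(T_{\mu_X}(a^-),T_{\mu_X}(b^+)\bigr)\quad\text{and}\quad\begin{cases}T'_{\mu_X}(b^+)=-\infty&\text{if }\theta>0,\\ T'_{\mu_X}(a^-)=-\infty&\text{if }\theta<0.\end{cases}$$ If $\theta<0$, suppose moreover that $\theta>-1$ (so that $I_n+P_n$ is positive definite) and $\mu_X(\{0\})=0$; both hold automatically if $a>0$. Let $\widetilde X_n=X_n(I_n+P_n)$, whose eigenvalues are all real. Then almost surely the following holds: for every sequence $(\widetilde u_n)_{n\ge1}$ in which $\widetilde u_n$ is a unit-norm eigenvector of $\widetilde X_n$ associated with its largest eigenvalue if $\theta>0$, and with its smallest eigenvalue if $\theta<0$, the norm of the orthogonal projection of $\widetilde u_n$ onto $\ker(\theta I_n-P_n)$ tends to $0$ as $n\to\infty$. -/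

import Mathlib

open MeasureTheory ProbabilityTheory Filter Topology
open scoped ENNReal ComplexOrder

/-- The entrywise (product) sigma-algebra on square matrices; random matrices are measurable maps
into it. -/
instance matrixMeasurableSpace {𝕜 : Type*} [MeasurableSpace 𝕜] (n : ℕ) :
    MeasurableSpace (Matrix (Fin n) (Fin n) 𝕜) :=
  inferInstanceAs (MeasurableSpace (Fin n → Fin n → 𝕜))

/-- The law of the random matrix `X` is invariant under conjugation by the unitary group
(`𝕜 = ℂ`), which is the orthogonal group when `𝕜 = ℝ`. -/
def ConjInvariant {𝕜 Ω : Type*} [RCLike 𝕜] [MeasurableSpace Ω] (Pr : Measure Ω) {n : ℕ}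
    (X : Ω → Matrix (Fin n) (Fin n) 𝕜) : Prop :=
  ∀ U ∈ Matrix.unitaryGroup (Fin n) 𝕜,
    Measure.map (fun ω => U * X ω * star U) Pr = Measure.map X Pr

/-- The empirical eigenvalue distribution `(1/n) ∑ δ_{λ_j(A)}` of a Hermitian `n × n` matrix. -/
noncomputable def empiricalSpectralMeasure {𝕜 : Type*} [RCLike 𝕜] {n : ℕ}
    {A : Matrix (Fin n) (Fin n) 𝕜} (hA : A.IsHermitian) : Measure ℝ :=
  (n : ℝ≥0∞)⁻¹ • ∑ j, Measure.dirac (hA.eigenvalues j)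

/-- Weak convergence of a sequence of measures on the line: convergence of the integrals of all
bounded continuous functions. -/
def WeaklyConverges (ν : ℕ → Measure ℝ) (μ : Measure ℝ) : Prop :=
  ∀ f : BoundedContinuousFunction ℝ ℝ,
    Tendsto (fun n => ∫ t, f t ∂(ν n)) atTop (𝓝 (∫ t, f t ∂μ))

/-- The set of real eigenvalues of a square matrix. It is the whole spectrum for Hermitian
matrices, and also for `X * (1 + P)` with `X` positive semidefinite and `P` Hermitian, since this
matrix has the same characteristic polynomial as `X^(1/2) * (1 + P) * X^(1/2)`. -/
def realEigenvalues {𝕜 : Type*} [RCLike 𝕜] {n : ℕ} (A : Matrix (Fin n) (Fin n) 𝕜) : Set ℝ :=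
  {t : ℝ | Module.End.HasEigenvalue (Matrix.toEuclideanLin A) (t : 𝕜)}

/-- The largest eigenvalue `λ_1(A)`. -/
noncomputable def maxEigenvalue {𝕜 : Type*} [RCLike 𝕜] {n : ℕ}
    (A : Matrix (Fin n) (Fin n) 𝕜) : ℝ :=
  sSup (realEigenvalues A)

/-- The smallest eigenvalue `λ_n(A)`. -/
noncomputable def minEigenvalue {𝕜 : Type*} [RCLike 𝕜] {n : ℕ}
    (A : Matrix (Fin n) (Fin n) 𝕜) : ℝ :=
  sInf (realEigenvalues A)

/-- `v` is a unit-norm eigenvector of `A` with (real) eigenvalue `t`. -/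
def IsUnitEigenvector {𝕜 : Type*} [RCLike 𝕜] {n : ℕ} (A : Matrix (Fin n) (Fin n) 𝕜) (t : ℝ)
    (v : EuclideanSpace 𝕜 (Fin n)) : Prop :=
  ‖v‖ = 1 ∧ Module.End.HasEigenvector (Matrix.toEuclideanLin A) (t : 𝕜) v

/-- `ker (θ I - P)` as a subspace of the Euclidean space. -/
noncomputable def kerShift {𝕜 : Type*} [RCLike 𝕜] {n : ℕ} (θ : ℝ)
    (P : Matrix (Fin n) (Fin n) 𝕜) : Submodule 𝕜 (EuclideanSpace 𝕜 (Fin n)) :=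
  LinearMap.ker (Matrix.toEuclideanLin ((θ : 𝕜) • (1 : Matrix (Fin n) (Fin n) 𝕜) - P))

/-- The norm `⟨x, F⟩` of the orthogonal projection of `x` onto the subspace `F`. -/
noncomputable def projNorm {𝕜 : Type*} [RCLike 𝕜] {n : ℕ} (x : EuclideanSpace 𝕜 (Fin n))
    (F : Submodule 𝕜 (EuclideanSpace 𝕜 (Fin n))) : ℝ :=
  ‖F.starProjection x‖

/-- The T-transform `T_μ(z) = ∫ t / (z - t) dμ(t)` at real `z`; it is only used for `z` outside
the convex hull of the support of `μ`. -/
noncomputable def tTransform (μ : Measure ℝ) (z : ℝ) : ℝ := ∫ t, t / (z - t) ∂μ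

/-!
Write `P = θ v v*` with `v` a unit vector, and let `λ_i` be the eigenvalues of `X`, `v_i` the
coordinates of `v` in an eigenbasis of `X`. The average of `(⟨v, X^k v⟩ - n⁻¹ tr X^k)^4` over all
unitary conjugates of `X` is the same for every unit vector `v`, in particular for a normalised
vector of random signs, for which the deviation is a Rademacher chaos with fourth moment `O(n⁻²)`.
This is summable, so by conjugation invariance `⟨v, X^k v⟩ - n⁻¹ tr X^k` tends to `0` almost surely,
and by Weierstrass approximation the weighted spectral measures `∑ |v_i|² δ_{λ_i}` converge weakly
to `μ_X`.

If `u` is a unit eigenvector of `X (1 + P)` with eigenvalue `y`, its coordinates satisfy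
`(y - λ_i) u_i = θ λ_i ⟨v, u⟩ v_i`. If `⟨v, u⟩ ≠ 0`, pairing with `v` gives
`θ ∑ |v_i|² λ_i / (y - λ_i) = 1`, which in the subcritical regime prevents the extreme `y` from
staying away from the edge of the spectrum. Taking norms gives
`θ² |⟨v, u⟩|² ∑ |v_i|² λ_i² / (y - λ_i)² = 1`, and the sum is unbounded as `y` reaches the edge:
when the edge is nonzero, its limit dominates a multiple of the derivative of the T-transform. At
the lower edge `0` this domination fails; there the smallest eigenvalue `y` tends to `0`, so a
coordinate of `u` with `λ_i` away from `0` has size about `|θ| |⟨v, u⟩| |v_i|`, and since `|θ| < 1`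
a fixed proportion of the overlap has to come from the eigenvalues near `0`, where the limiting
weight `μ_X({0})` vanishes.
-/
/-! ### Fourth moments of Rademacher chaoses -/

section Rademacher

open scoped BigOperators

lemma dependsOn_sum_mul_sign {ι : Type*} (c : ι → ℝ) {s : Finset ι} {k : ι}
    (hk : k ∉ s) :
    DependsOn (fun ε : ι → ℤˣ => ∑ i ∈ s, c i * ((ε i : ℤ) : ℝ)) {k}ᶜ := fun ε ε' h =>
  Finset.sum_congr rfl fun i hi => by rw [h i (ne_of_mem_of_not_mem hi hk)]

variable {ι : Type*} [Fintype ι] [DecidableEq ι]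

lemma expect_add_sign_mul_pow_four {i : ι} {g h : (ι → ℤˣ) → ℝ} (hg : DependsOn g {i}ᶜ)
    (hh : DependsOn h {i}ᶜ) :
    𝔼 ε, (h ε + ((ε i : ℤ) : ℝ) * g ε) ^ 4 =
      𝔼 ε, (h ε ^ 4 + 6 * (h ε * g ε) ^ 2 + g ε ^ 4) := by
  let flip : (ι → ℤˣ) ≃ (ι → ℤˣ) := Equiv.mulRight (Pi.mulSingle i (-1))
  have flip_at : ∀ ε, flip ε i = -ε i := fun ε => by simp [flip]
  have flip_off : ∀ ε, ∀ j ∈ ({i}ᶜ : Set ι), flip ε j = ε j := fun ε j hj => by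
    simp [flip, Pi.mulSingle_eq_of_ne (by simpa using hj : j ≠ i)]
  have hflip : 𝔼 ε, (h ε + ((ε i : ℤ) : ℝ) * g ε) ^ 4 =
      𝔼 ε, (h ε - ((ε i : ℤ) : ℝ) * g ε) ^ 4 := by
    refine (Fintype.expect_equiv flip _ _ fun ε => ?_).symm
    rw [hg (flip_off ε), hh (flip_off ε), flip_at]
    push_cast
    ring
  have hsq : ∀ ε : ι → ℤˣ, ((ε i : ℤ) : ℝ) ^ 2 = 1 := fun ε => by
    rcases Int.units_eq_one_or (ε i) with h | h <;> simp [h]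
  have hpow : ∀ ε : ι → ℤˣ,
      (h ε + ((ε i : ℤ) : ℝ) * g ε) ^ 4 + (h ε - ((ε i : ℤ) : ℝ) * g ε) ^ 4 =
        2 * (h ε ^ 4 + 6 * (h ε * g ε) ^ 2 + g ε ^ 4) := fun ε => by
    linear_combination (12 * h ε ^ 2 * g ε ^ 2 +
      2 * g ε ^ 4 * (((ε i : ℤ) : ℝ) ^ 2 + 1)) * hsq ε
  have hsum := Finset.expect_congr (s := Finset.univ) rfl fun ε _ => hpow ε
  rw [Finset.expect_add_distrib, ← hflip, ← Finset.mul_expect] at hsum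
  linarith

lemma expect_add_sign_mul_pow_four_le {i : ι} {g h : (ι → ℤˣ) → ℝ} (hg : DependsOn g {i}ᶜ)
    (hh : DependsOn h {i}ᶜ) {G H : ℝ} (hG0 : 0 ≤ G) (hH0 : 0 ≤ H)
    (hG : 𝔼 ε, g ε ^ 4 ≤ G ^ 2) (hH : 𝔼 ε, h ε ^ 4 ≤ H ^ 2) :
    𝔼 ε, (h ε + ((ε i : ℤ) : ℝ) * g ε) ^ 4 ≤ (H + 3 * G) ^ 2 := by
  have hcross : 𝔼 ε, (h ε * g ε) ^ 2 ≤ H * G := by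
    refine (abs_le_of_sq_le_sq' ?_ (mul_nonneg hH0 hG0)).2
    have hcs := Finset.expect_mul_sq_le_sq_mul_sq Finset.univ (fun ε => h ε ^ 2) fun ε => g ε ^ 2
    simp only [← pow_mul, ← mul_pow, Nat.reduceMul] at hcs
    calc _ ≤ (𝔼 ε, h ε ^ 4) * 𝔼 ε, g ε ^ 4 := hcs
      _ ≤ H ^ 2 * G ^ 2 := by
        gcongr
      _ = (H * G) ^ 2 := by ring
  rw [expect_add_sign_mul_pow_four hg hh, Finset.expect_add_distrib, Finset.expect_add_distrib,
    ← Finset.mul_expect]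
  nlinarith [sq_nonneg G]

lemma expect_sum_mul_sign_pow_four_le (c : ι → ℝ) (s : Finset ι) :
    𝔼 ε : ι → ℤˣ, (∑ i ∈ s, c i * ((ε i : ℤ) : ℝ)) ^ 4 ≤ (3 * ∑ i ∈ s, c i ^ 2) ^ 2 := by
  induction s using Finset.induction_on with
  | empty => simp
  | insert k s hk ih =>
    have h := expect_add_sign_mul_pow_four_le (g := fun _ => c k) (G := c k ^ 2)
      (fun _ _ _ => rfl) (dependsOn_sum_mul_sign c hk) (sq_nonneg _) (by positivity)
      (by rw [Fintype.expect_const]; exact (by ring : c k ^ 4 = _).le) ih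
    simp only [Finset.sum_insert hk]
    convert h using 3 <;> ring

lemma expect_sum_sum_mul_sign_pow_four_le {m : ι → ι → ℝ} (hm : ∀ i, m i i = 0) (s : Finset ι) :
    𝔼 ε : ι → ℤˣ, (∑ i ∈ s, ∑ j ∈ s, m i j * (((ε i : ℤ) : ℝ) * ((ε j : ℤ) : ℝ))) ^ 4 ≤
      (18 * ∑ i ∈ s, ∑ j ∈ s, m i j ^ 2) ^ 2 := by
  induction s using Finset.induction_on with
  | empty => simp
  | insert k s hk ih =>
    have hlin := expect_sum_mul_sign_pow_four_le (fun i => m i k + m k i) s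
    have hquad : DependsOn (fun ε : ι → ℤˣ =>
        ∑ i ∈ s, ∑ j ∈ s, m i j * (((ε i : ℤ) : ℝ) * ((ε j : ℤ) : ℝ))) {k}ᶜ := fun ε ε' h =>
      Finset.sum_congr rfl fun i hi => Finset.sum_congr rfl fun j hj => by
        rw [h i (ne_of_mem_of_not_mem hi hk), h j (ne_of_mem_of_not_mem hj hk)]
    have h := expect_add_sign_mul_pow_four_le (dependsOn_sum_mul_sign _ hk) hquad
      (by positivity) (by positivity) hlin ih
    have hcoeff : ∑ i ∈ s, (m i k + m k i) ^ 2 ≤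
        2 * (∑ i ∈ s, m i k ^ 2 + ∑ i ∈ s, m k i ^ 2) := by
      rw [← Finset.sum_add_distrib, Finset.mul_sum]
      exact Finset.sum_le_sum fun i _ => by nlinarith [sq_nonneg (m i k - m k i)]
    simp only [Finset.sum_insert hk, hm, Finset.sum_add_distrib]
    calc _ = _ := Finset.expect_congr rfl fun ε _ => ?_
      _ ≤ _ := h
      _ ≤ _ := by gcongr; linarith
    have hrow : ∑ i ∈ s, (m i k + m k i) * ((ε i : ℤ) : ℝ) =
        ∑ i ∈ s, m i k * ((ε i : ℤ) : ℝ) + ∑ i ∈ s, m k i * ((ε i : ℤ) : ℝ) := by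
      simp only [add_mul, Finset.sum_add_distrib]
    have hleft : ∑ j ∈ s, m k j * (((ε k : ℤ) : ℝ) * ((ε j : ℤ) : ℝ)) =
        ((ε k : ℤ) : ℝ) * ∑ j ∈ s, m k j * ((ε j : ℤ) : ℝ) := by
      simp only [Finset.mul_sum, mul_left_comm]
    have hright : ∑ i ∈ s, m i k * (((ε i : ℤ) : ℝ) * ((ε k : ℤ) : ℝ)) =
        ((ε k : ℤ) : ℝ) * ∑ i ∈ s, m i k * ((ε i : ℤ) : ℝ) := by
      simp only [Finset.mul_sum, mul_comm, mul_left_comm]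
    rw [hrow, hleft, hright]
    ring

end Rademacher

section SignVector

open scoped BigOperators Matrix

variable {𝕜 m : Type*} [RCLike 𝕜] [Fintype m]

/-- The vector whose coordinates are the signs `ε`, normalised to Euclidean norm one. -/
noncomputable def signVector (𝕜 : Type*) {m : Type*} [RCLike 𝕜] [Fintype m] (ε : m → ℤˣ) :
    m → 𝕜 :=
  fun i => ((((ε i : ℤ) : ℝ) / √(Fintype.card m) : ℝ) : 𝕜)

lemma sum_norm_sq_signVector [Nonempty m] (ε : m → ℤˣ) : ∑ i, ‖signVector 𝕜 ε i‖ ^ 2 = 1 := by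
  have hsq : ∀ i, (((ε i : ℤ) : ℝ)) ^ 2 = 1 := fun i => by
    rcases Int.units_eq_one_or (ε i) with h | h <;> simp [h]
  simp [signVector, -map_div₀, -map_intCast, div_pow, hsq]

lemma re_quadForm_signVector (N : Matrix m m 𝕜) (ε : m → ℤˣ) :
    RCLike.re (star (signVector 𝕜 ε) ⬝ᵥ N *ᵥ signVector 𝕜 ε) =
      (∑ i, ∑ j, RCLike.re (N i j) * (((ε i : ℤ) : ℝ) * ((ε j : ℤ) : ℝ))) / Fintype.card m := by
  have hinv : (Fintype.card m : ℝ)⁻¹ = (√(Fintype.card m))⁻¹ * (√(Fintype.card m))⁻¹ := by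
    rw [← mul_inv, Real.mul_self_sqrt (Nat.cast_nonneg _)]
  simp only [dotProduct, Matrix.mulVec, signVector, Pi.star_apply, RCLike.star_def,
    RCLike.conj_ofReal, map_sum, RCLike.re_ofReal_mul, RCLike.re_mul_ofReal, Finset.mul_sum,
    Finset.sum_div]
  refine Finset.sum_congr rfl fun i _ => Finset.sum_congr rfl fun j _ => ?_
  rw [div_eq_mul_inv _ (Fintype.card m : ℝ), hinv]
  ring

lemma re_trace_mul_self_of_isHermitian {N : Matrix m m 𝕜} (hN : N.IsHermitian) :
    RCLike.re (N * N).trace = ∑ i, ∑ j, ‖N i j‖ ^ 2 := by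
  simp only [Matrix.trace, Matrix.diag_apply, Matrix.mul_apply, map_sum]
  refine Finset.sum_congr rfl fun i _ => Finset.sum_congr rfl fun j _ => ?_
  rw [← hN.apply j i, RCLike.star_def, RCLike.mul_conj]
  norm_cast

lemma expect_quadForm_signVector_sub_pow_four_le [DecidableEq m] {N : Matrix m m 𝕜}
    (hN : N.IsHermitian) :
    𝔼 ε, (RCLike.re (star (signVector 𝕜 ε) ⬝ᵥ N *ᵥ signVector 𝕜 ε) -
        RCLike.re N.trace / Fintype.card m) ^ 4 ≤
      (18 * RCLike.re (N * N).trace) ^ 2 / Fintype.card m ^ 4 := by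
  let offDiag : m → m → ℝ := fun i j => if i = j then 0 else RCLike.re (N i j)
  have hoff : ∑ i, ∑ j, offDiag i j ^ 2 ≤ RCLike.re (N * N).trace := by
    rw [re_trace_mul_self_of_isHermitian hN]
    refine Finset.sum_le_sum fun i _ => Finset.sum_le_sum fun j _ => ?_
    rw [RCLike.norm_sq_eq_def]
    unfold offDiag
    split_ifs <;> nlinarith [sq_nonneg (RCLike.re (N i j)), sq_nonneg (RCLike.im (N i j))]
  have hdiag : ∀ ε : m → ℤˣ, ∑ i, ∑ j, RCLike.re (N i j) * (((ε i : ℤ) : ℝ) * ((ε j : ℤ) : ℝ)) =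
      ∑ i, ∑ j, offDiag i j * (((ε i : ℤ) : ℝ) * ((ε j : ℤ) : ℝ)) + RCLike.re N.trace :=
    fun ε => by
    have hentry : ∀ i j, RCLike.re (N i j) * (((ε i : ℤ) : ℝ) * ((ε j : ℤ) : ℝ)) =
        offDiag i j * (((ε i : ℤ) : ℝ) * ((ε j : ℤ) : ℝ)) +
          if i = j then RCLike.re (N i i) else 0 := fun i j => by
      unfold offDiag
      split_ifs with h
      · subst h
        rcases Int.units_eq_one_or (ε i) with hε | hε <;> simp [hε]
      · ring
    simp only [hentry, Finset.sum_add_distrib, Finset.sum_ite_eq, Finset.mem_univ, if_true,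
      Matrix.trace, Matrix.diag_apply, map_sum]
  simp only [re_quadForm_signVector, hdiag, add_div, add_sub_cancel_right, div_pow]
  rw [← Finset.expect_div]
  gcongr
  refine (expect_sum_sum_mul_sign_pow_four_le (by simp [offDiag]) Finset.univ).trans ?_
  gcongr

end SignVector

/-! ### The unitary group and rank one matrices -/

section Unitary

open scoped Matrix

variable {𝕜 m : Type*} [RCLike 𝕜] [Fintype m]

/-- The Hermitian matrix `θ v v*`. For a unit vector `v` it has rank one and sole nonzero
eigenvalue `θ`. -/
def rankOneMatrix (θ : ℝ) (v : m → 𝕜) : Matrix m m 𝕜 :=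
  (θ : 𝕜) • Matrix.vecMulVec v (star v)

lemma mul_rankOneMatrix_mul_conjTranspose (A : Matrix m m 𝕜) (θ : ℝ) (v : m → 𝕜) :
    A * rankOneMatrix θ v * Aᴴ = rankOneMatrix θ (A *ᵥ v) := by
  rw [rankOneMatrix, rankOneMatrix, mul_smul_comm, smul_mul_assoc, Matrix.mul_vecMulVec,
    Matrix.vecMulVec_mul, Matrix.star_mulVec]

lemma rankOneMatrix_mulVec (θ : ℝ) (v w : m → 𝕜) :
    rankOneMatrix θ v *ᵥ w = ((θ : 𝕜) * (star v ⬝ᵥ w)) • v := by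
  rw [rankOneMatrix, Matrix.smul_mulVec, Matrix.vecMulVec_mulVec, op_smul_eq_smul, smul_smul]

lemma trace_rankOneMatrix_mul (θ : ℝ) (v : m → 𝕜) (A : Matrix m m 𝕜) :
    (rankOneMatrix θ v * A).trace = θ * (star v ⬝ᵥ A *ᵥ v) := by
  rw [rankOneMatrix, smul_mul_assoc, Matrix.trace_smul, smul_eq_mul, Matrix.vecMulVec_mul,
    Matrix.trace_vecMulVec, dotProduct_comm, ← Matrix.dotProduct_mulVec]

variable [DecidableEq m]

instance compactSpace_unitaryGroup : CompactSpace (Matrix.unitaryGroup m 𝕜) := by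
  have hbox : IsCompact (Set.pi Set.univ fun _ : m => Set.pi Set.univ fun _ : m =>
      Metric.closedBall (0 : 𝕜) 1) :=
    isCompact_univ_pi fun _ => isCompact_univ_pi fun _ => isCompact_closedBall _ _
  have hclosed : IsClosed (Matrix.unitaryGroup m 𝕜 : Set (Matrix m m 𝕜)) := isClosed_unitary
  exact isCompact_iff_compactSpace.1 (hbox.of_isClosed_subset hclosed fun U hU i _ j _ => by
    simpa using entry_norm_bound_of_unitary hU i j)

lemma exists_unitary_mulVec_single_eq (i : m) {v : m → 𝕜} (hv : ∑ j, ‖v j‖ ^ 2 = 1) :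
    ∃ U ∈ Matrix.unitaryGroup m 𝕜, U *ᵥ Pi.single i 1 = v := by
  have hv' : ‖WithLp.toLp 2 v‖ = 1 := by simp [EuclideanSpace.norm_eq, hv]
  obtain ⟨b, hb⟩ := Orthonormal.exists_orthonormalBasis_extension_of_card_eq (𝕜 := 𝕜)
    (E := EuclideanSpace 𝕜 m) (ι := m) (by simp) (v := fun _ => WithLp.toLp 2 v) (s := {i})
    ⟨fun _ => hv', fun x y hxy => absurd (Subsingleton.elim x y) hxy⟩
  refine ⟨(EuclideanSpace.basisFun m 𝕜).toBasis.toMatrix b,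
    (EuclideanSpace.basisFun m 𝕜).toMatrix_orthonormalBasis_mem_unitary b, ?_⟩
  ext j
  simp [Module.Basis.toMatrix_apply, hb i rfl]

lemma exists_unitary_mulVec_eq {v w : m → 𝕜} (hv : ∑ j, ‖v j‖ ^ 2 = 1)
    (hw : ∑ j, ‖w j‖ ^ 2 = 1) : ∃ U ∈ Matrix.unitaryGroup m 𝕜, U *ᵥ v = w := by
  obtain ⟨i, -⟩ : ∃ i, v i ≠ 0 := by
    by_contra! h
    simp [h] at hv
  obtain ⟨V, hV, hVv⟩ := exists_unitary_mulVec_single_eq i hv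
  obtain ⟨W, hW, hWw⟩ := exists_unitary_mulVec_single_eq i hw
  refine ⟨W * star V, mul_mem hW (Unitary.star_mem hV), ?_⟩
  rw [← hVv, Matrix.mulVec_mulVec, mul_assoc, Matrix.mem_unitaryGroup_iff'.1 hV, mul_one, hWw]

end Unitary

/-! ### Concentration of quadratic forms -/

section TraceDeviation

open scoped BigOperators Matrix

variable {𝕜 m : Type*} [RCLike 𝕜] [Fintype m]

/-- The fourth power of the deviation of `tr (B M) / θ`, which is `v* M v` when `B = θ v v*`, from
the normalised trace `tr M / n`. The denominator makes the expectation over a uniformly distributed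
`v` at most a multiple of `n⁻²`, uniformly in the Hermitian matrix `M`. -/
noncomputable def traceDeviation (θ : ℝ) (M B : Matrix m m 𝕜) : ℝ :=
  (RCLike.re (B * M).trace / θ - RCLike.re M.trace / Fintype.card m) ^ 4 /
    (1 + (RCLike.re (M * M).trace / Fintype.card m) ^ 2)

lemma traceDeviation_nonneg (θ : ℝ) (M B : Matrix m m 𝕜) : 0 ≤ traceDeviation θ M B :=
  div_nonneg (by positivity) (by positivity)

lemma continuous_traceDeviation (θ : ℝ) :
    Continuous fun z : Matrix m m 𝕜 × Matrix m m 𝕜 => traceDeviation θ z.1 z.2 := by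
  have hre : ∀ {f : Matrix m m 𝕜 × Matrix m m 𝕜 → Matrix m m 𝕜}, Continuous f →
      Continuous fun z => RCLike.re (f z).trace :=
    fun hf => RCLike.continuous_re.comp hf.matrix_trace
  refine Continuous.div ?_ ?_ fun z => by positivity
  · exact (((hre (continuous_snd.mul continuous_fst)).div_const _).sub
      ((hre continuous_fst).div_const _)).pow 4
  · exact continuous_const.add (((hre (continuous_fst.mul continuous_fst)).div_const _).pow 2)

variable [DecidableEq m]

lemma traceDeviation_conj (θ : ℝ) {U : Matrix m m 𝕜} (hU : U ∈ Matrix.unitaryGroup m 𝕜)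
    (M B : Matrix m m 𝕜) :
    traceDeviation θ (U * M * star U) (U * B * star U) = traceDeviation θ M B := by
  have hmul : ∀ C D : Matrix m m 𝕜, U * C * star U * (U * D * star U) = U * (C * D) * star U :=
    fun C D => (map_mul (Unitary.conjStarAlgAut 𝕜 _ (⟨U, hU⟩ : Matrix.unitaryGroup m 𝕜)) C D).symm
  have htrace : ∀ C : Matrix m m 𝕜, (U * C * star U).trace = C.trace := fun C => by
    rw [Matrix.trace_mul_comm, ← mul_assoc, Matrix.mem_unitaryGroup_iff'.1 hU, one_mul]
  rw [traceDeviation, traceDeviation, hmul, hmul, htrace, htrace, htrace]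

lemma expect_traceDeviation_signVector_le {θ : ℝ} (hθ : θ ≠ 0) {M : Matrix m m 𝕜}
    (hM : M.IsHermitian) :
    𝔼 ε, traceDeviation θ M (rankOneMatrix θ (signVector 𝕜 ε)) ≤ 324 / Fintype.card m ^ 2 := by
  simp only [traceDeviation, trace_rankOneMatrix_mul, RCLike.re_ofReal_mul,
    mul_div_cancel_left₀ _ hθ]
  rw [← Finset.expect_div, div_le_iff₀ (by positivity)]
  calc _ ≤ _ := expect_quadForm_signVector_sub_pow_four_le hM
    _ = 324 / Fintype.card m ^ 2 * (RCLike.re (M * M).trace / Fintype.card m) ^ 2 := by ring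
    _ ≤ _ := by
      gcongr
      linarith

end TraceDeviation

section HaarAveraging

open scoped Matrix

variable {𝕜 : Type*} [RCLike 𝕜] {n : ℕ}

instance borelSpace_matrix : BorelSpace (Matrix (Fin n) (Fin n) 𝕜) :=
  inferInstanceAs (BorelSpace (Fin n → Fin n → 𝕜))

instance secondCountableTopology_matrix :
    SecondCountableTopology (Matrix (Fin n) (Fin n) 𝕜) :=
  inferInstanceAs (SecondCountableTopology (Fin n → Fin n → 𝕜))

instance borelSpace_unitaryGroup : BorelSpace (Matrix.unitaryGroup (Fin n) 𝕜) :=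
  Subtype.borelSpace _

instance secondCountableTopology_unitaryGroup :
    SecondCountableTopology (Matrix.unitaryGroup (Fin n) 𝕜) :=
  TopologicalSpace.Subtype.secondCountableTopology _

lemma exists_isProbabilityMeasure_isMulLeftInvariant (G : Type*) [Group G] [TopologicalSpace G]
    [IsTopologicalGroup G] [CompactSpace G] [MeasurableSpace G] [BorelSpace G] :
    ∃ ρ : Measure G, IsProbabilityMeasure ρ ∧ ρ.IsMulLeftInvariant :=
  ⟨Measure.haarMeasure ⊤, ⟨by
    simpa using Measure.haarMeasure_self (K₀ := (⊤ : TopologicalSpace.PositiveCompacts G))⟩,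
    inferInstance⟩

lemma measurable_traceDeviation {α : Type*} [MeasurableSpace α] (θ : ℝ)
    {M B : α → Matrix (Fin n) (Fin n) 𝕜} (hM : Measurable M) (hB : Measurable B) :
    Measurable fun x => traceDeviation θ (M x) (B x) := by
  have hdev := (continuous_traceDeviation θ).measurable.comp (hM.prodMk hB)
  exact hdev

lemma measurable_traceDeviation_conj {α : Type*} [MeasurableSpace α] (θ : ℝ)
    {U : α → Matrix.unitaryGroup (Fin n) 𝕜} {M B : α → Matrix (Fin n) (Fin n) 𝕜}
    (hU : Measurable U) (hM : Measurable M) (hB : Measurable B) :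
    Measurable fun x => traceDeviation θ ((U x).1 * M x * star (U x).1) (B x) := by
  have hconj := (show Continuous fun z : Matrix.unitaryGroup (Fin n) 𝕜 × Matrix (Fin n) (Fin n) 𝕜 =>
      z.1.1 * z.2 * star z.1.1 by fun_prop).measurable.comp (hU.prodMk hM)
  exact measurable_traceDeviation θ hconj hB

variable (ρ : Measure (Matrix.unitaryGroup (Fin n) 𝕜))

lemma sum_lintegral_traceDeviation_signVector_le [IsProbabilityMeasure ρ] {θ : ℝ} (hθ : θ ≠ 0)
    {M : Matrix (Fin n) (Fin n) 𝕜} (hM : M.IsHermitian) :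
    ∑ ε : Fin n → ℤˣ, ∫⁻ U : Matrix.unitaryGroup (Fin n) 𝕜, .ofReal
        (traceDeviation θ (U.1 * M * star U.1) (rankOneMatrix θ (signVector 𝕜 ε))) ∂ρ ≤
      Fintype.card (Fin n → ℤˣ) * .ofReal (324 / n ^ 2) := by
  have hsum : ∀ U : Matrix.unitaryGroup (Fin n) 𝕜, ∑ ε : Fin n → ℤˣ,
      traceDeviation θ (U.1 * M * star U.1) (rankOneMatrix θ (signVector 𝕜 ε)) ≤
        Fintype.card (Fin n → ℤˣ) * (324 / n ^ 2) := fun U => by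
    have hUM : (U.1 * M * star U.1).IsHermitian := Matrix.isHermitian_mul_mul_conjTranspose _ hM
    have h := expect_traceDeviation_signVector_le hθ hUM
    rw [← Fintype.card_mul_expect]
    gcongr
    simpa using h
  have hmeas : ∀ ε : Fin n → ℤˣ, Measurable fun U : Matrix.unitaryGroup (Fin n) 𝕜 =>
      ENNReal.ofReal (traceDeviation θ (U.1 * M * star U.1) (rankOneMatrix θ (signVector 𝕜 ε))) :=
    fun ε => (measurable_traceDeviation_conj θ measurable_id measurable_const
      measurable_const).ennreal_ofReal
  calc _ = ∫⁻ U : Matrix.unitaryGroup (Fin n) 𝕜, .ofReal (∑ ε : Fin n → ℤˣ,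
          traceDeviation θ (U.1 * M * star U.1) (rankOneMatrix θ (signVector 𝕜 ε))) ∂ρ := by
        rw [← lintegral_finsetSum _ fun ε _ => hmeas ε]
        simp only [ENNReal.ofReal_sum_of_nonneg fun _ _ => traceDeviation_nonneg _ _ _]
    _ ≤ ∫⁻ _, .ofReal (Fintype.card (Fin n → ℤˣ) * (324 / n ^ 2)) ∂ρ :=
        lintegral_mono fun U => ENNReal.ofReal_le_ofReal (hsum U)
    _ = _ := by simp [ENNReal.ofReal_mul]

variable [ρ.IsMulLeftInvariant]

lemma lintegral_traceDeviation_rankOneMatrix_eq (θ : ℝ) (M : Matrix (Fin n) (Fin n) 𝕜)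
    {v w : Fin n → 𝕜} (hv : ∑ i, ‖v i‖ ^ 2 = 1) (hw : ∑ i, ‖w i‖ ^ 2 = 1) :
    ∫⁻ U : Matrix.unitaryGroup (Fin n) 𝕜, .ofReal (traceDeviation θ (U.1 * M * star U.1)
        (rankOneMatrix θ v)) ∂ρ =
      ∫⁻ U : Matrix.unitaryGroup (Fin n) 𝕜, .ofReal (traceDeviation θ (U.1 * M * star U.1)
        (rankOneMatrix θ w)) ∂ρ := by
  obtain ⟨V, hV, rfl⟩ := exists_unitary_mulVec_eq hw hv
  rw [← lintegral_mul_left_eq_self _ (⟨V, hV⟩ : Matrix.unitaryGroup (Fin n) 𝕜)]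
  refine lintegral_congr fun U => ?_
  rw [← mul_rankOneMatrix_mul_conjTranspose, ← Matrix.star_eq_conjTranspose,
    ← traceDeviation_conj θ hV (U.1 * M * star U.1)]
  simp [mul_assoc]

lemma lintegral_traceDeviation_conj_le [IsProbabilityMeasure ρ] {θ : ℝ} (hθ : θ ≠ 0)
    {M : Matrix (Fin n) (Fin n) 𝕜} (hM : M.IsHermitian) {v : Fin n → 𝕜}
    (hv : ∑ i, ‖v i‖ ^ 2 = 1) :
    ∫⁻ U : Matrix.unitaryGroup (Fin n) 𝕜, .ofReal (traceDeviation θ (U.1 * M * star U.1)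
      (rankOneMatrix θ v)) ∂ρ ≤ .ofReal (324 / n ^ 2) := by
  have : Nonempty (Fin n) := by
    by_contra h
    simp [not_nonempty_iff.1 h] at hv
  have h := sum_lintegral_traceDeviation_signVector_le ρ hθ hM
  rw [Finset.sum_congr rfl fun ε _ => lintegral_traceDeviation_rankOneMatrix_eq ρ θ M
    (sum_norm_sq_signVector ε) hv, Finset.sum_const, nsmul_eq_mul, Finset.card_univ] at h
  exact (ENNReal.mul_le_mul_iff_right (by simp) (by simp)).1 h

end HaarAveraging

section ConjInvariant

variable {𝕜 Ω : Type*} [RCLike 𝕜] [MeasurableSpace Ω] {Pr : Measure Ω} {n : ℕ}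
  {X P : Ω → Matrix (Fin n) (Fin n) 𝕜}

lemma measurable_conj (U : Matrix (Fin n) (Fin n) 𝕜) :
    Measurable fun A : Matrix (Fin n) (Fin n) 𝕜 => U * A * star U :=
  Continuous.measurable (by fun_prop)

lemma ConjInvariant.identDistrib (h : ConjInvariant Pr X) (hX : Measurable X)
    {U : Matrix (Fin n) (Fin n) 𝕜} (hU : U ∈ Matrix.unitaryGroup (Fin n) 𝕜) :
    IdentDistrib (fun ω => U * X ω * star U) X Pr Pr :=
  ⟨((measurable_conj U).comp hX).aemeasurable, hX.aemeasurable, h U hU⟩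

lemma ConjInvariant.pow (h : ConjInvariant Pr X) (hX : Measurable X) (k : ℕ) :
    ConjInvariant Pr fun ω => X ω ^ k := fun U hU => by
  have hpow : Measurable fun A : Matrix (Fin n) (Fin n) 𝕜 => A ^ k :=
    Continuous.measurable (by fun_prop)
  have hconj : ∀ ω, (U * X ω * star U) ^ k = U * X ω ^ k * star U := fun ω =>
    (map_pow (Unitary.conjStarAlgAut 𝕜 _ (⟨U, hU⟩ : Matrix.unitaryGroup (Fin n) 𝕜)) (X ω) k).symm
  simp only [← hconj]
  exact ((h.identDistrib hX hU).comp hpow).map_eq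

lemma lintegral_conj_eq [IsProbabilityMeasure Pr] (hX : Measurable X) (hP : Measurable P)
    (hindep : IndepFun X P Pr) (hinv : ConjInvariant Pr X ∨ ConjInvariant Pr P)
    {G : Matrix (Fin n) (Fin n) 𝕜 × Matrix (Fin n) (Fin n) 𝕜 → ℝ≥0∞} (hG : Measurable G)
    (hGconj : ∀ U ∈ Matrix.unitaryGroup (Fin n) 𝕜, ∀ A B,
      G (U * A * star U, U * B * star U) = G (A, B))
    {U : Matrix (Fin n) (Fin n) 𝕜} (hU : U ∈ Matrix.unitaryGroup (Fin n) 𝕜) :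
    ∫⁻ ω, G (U * X ω * star U, P ω) ∂Pr = ∫⁻ ω, G (X ω, P ω) ∂Pr := by
  rcases hinv with hinv | hinv
  · have hpair := (hinv.identDistrib hX hU).prodMk (IdentDistrib.refl hP.aemeasurable)
      (hindep.comp (measurable_conj U) measurable_id) hindep
    exact (hpair.comp hG).lintegral_eq
  · have hU' := Unitary.star_mem hU
    have hpair := (IdentDistrib.refl hX.aemeasurable).prodMk (hinv.identDistrib hP hU')
      (hindep.comp measurable_id (measurable_conj (star U))) hindep
    refine Eq.trans (lintegral_congr fun ω => ?_) (hpair.comp hG).lintegral_eq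
    rw [Function.comp_apply]
    rw [← hGconj _ hU']
    simp [mul_assoc, Unitary.star_mul_self_of_mem hU, ← mul_assoc (star U) U]

lemma lintegral_traceDeviation_le [IsProbabilityMeasure Pr] (hX : Measurable X)
    (hP : Measurable P) (hindep : IndepFun X P Pr) (hinv : ConjInvariant Pr X ∨ ConjInvariant Pr P)
    (hXherm : ∀ ω, (X ω).IsHermitian) {θ : ℝ} (hθ : θ ≠ 0)
    (hPv : ∀ ω, ∃ v, ∑ i, ‖v i‖ ^ 2 = 1 ∧ P ω = rankOneMatrix θ v) :
    ∫⁻ ω, .ofReal (traceDeviation θ (X ω) (P ω)) ∂Pr ≤ .ofReal (324 / n ^ 2) := by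
  obtain ⟨ρ, _, _⟩ :=
    exists_isProbabilityMeasure_isMulLeftInvariant (Matrix.unitaryGroup (Fin n) 𝕜)
  have hmeas : Measurable fun z : Matrix.unitaryGroup (Fin n) 𝕜 × Ω =>
      ENNReal.ofReal (traceDeviation θ (z.1.1 * X z.2 * star z.1.1) (P z.2)) :=
    (measurable_traceDeviation_conj θ measurable_fst (hX.comp measurable_snd)
      (hP.comp measurable_snd)).ennreal_ofReal
  calc ∫⁻ ω, .ofReal (traceDeviation θ (X ω) (P ω)) ∂Pr
    _ = ∫⁻ U : Matrix.unitaryGroup (Fin n) 𝕜, ∫⁻ ω,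
          .ofReal (traceDeviation θ (U.1 * X ω * star U.1) (P ω)) ∂Pr ∂ρ := by
        have hconj := fun U : Matrix.unitaryGroup (Fin n) 𝕜 => lintegral_conj_eq hX hP hindep hinv
          (G := fun z => .ofReal (traceDeviation θ z.1 z.2))
          (continuous_traceDeviation θ).measurable.ennreal_ofReal
          (fun V hV A B => by rw [traceDeviation_conj θ hV]) U.2
        simp [hconj]
    _ = ∫⁻ ω, ∫⁻ U : Matrix.unitaryGroup (Fin n) 𝕜,
          .ofReal (traceDeviation θ (U.1 * X ω * star U.1) (P ω)) ∂ρ ∂Pr :=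
        lintegral_lintegral_swap hmeas.aemeasurable
    _ ≤ ∫⁻ _, .ofReal (324 / n ^ 2) ∂Pr := lintegral_mono fun ω => by
        obtain ⟨v, hv, hPω⟩ := hPv ω
        simpa only [hPω] using lintegral_traceDeviation_conj_le ρ hθ (hXherm ω) hv
    _ = .ofReal (324 / n ^ 2) := by simp

end ConjInvariant

section AlmostSure

variable {𝕜 Ω : Type*} [RCLike 𝕜] [MeasurableSpace Ω] {Pr : Measure Ω}

lemma ae_tendsto_zero_of_lintegral_le {f : ℕ → Ω → ℝ} (hf : ∀ n, Measurable (f n))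
    (hf0 : ∀ n ω, 0 ≤ f n ω) {c : ℕ → ℝ} (hc : Summable c)
    (hfc : ∀ n, ∫⁻ ω, .ofReal (f n ω) ∂Pr ≤ .ofReal (c n)) :
    ∀ᵐ ω ∂Pr, Tendsto (fun n => f n ω) atTop (𝓝 0) := by
  have hsum : ∫⁻ ω, ∑' n, .ofReal (f n ω) ∂Pr ≠ ∞ := by
    rw [lintegral_tsum fun n => (hf n).ennreal_ofReal.aemeasurable]
    exact ne_top_of_le_ne_top hc.tsum_ofReal_ne_top (ENNReal.tsum_le_tsum hfc)
  filter_upwards [ae_lt_top (Measurable.tsum fun n => (hf n).ennreal_ofReal) hsum] with ω hω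
  refine ((ENNReal.tendsto_toReal ENNReal.zero_ne_top).comp
    (ENNReal.tendsto_atTop_zero_of_tsum_ne_top hω.ne)).congr fun n => ?_
  exact ENNReal.toReal_ofReal (hf0 n ω)

variable [IsProbabilityMeasure Pr] {X P : (n : ℕ) → Ω → Matrix (Fin n) (Fin n) 𝕜}

lemma ae_tendsto_traceDeviation (hX : ∀ n, Measurable (X n)) (hP : ∀ n, Measurable (P n))
    (hindep : ∀ n, IndepFun (X n) (P n) Pr)
    (hinv : ∀ n, ConjInvariant Pr (X n) ∨ ConjInvariant Pr (P n))
    (hXherm : ∀ n ω, (X n ω).IsHermitian) {θ : ℝ} (hθ : θ ≠ 0)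
    (hPv : ∀ n, 1 ≤ n → ∀ ω, ∃ v, ∑ i, ‖v i‖ ^ 2 = 1 ∧ P n ω = rankOneMatrix θ v) :
    ∀ᵐ ω ∂Pr, Tendsto (fun n => traceDeviation θ (X n ω) (P n ω)) atTop (𝓝 0) := by
  have hc : Summable fun n : ℕ => (324 : ℝ) / (n + 1 : ℕ) ^ 2 := by
    simpa [div_eq_mul_inv] using
      ((summable_nat_add_iff 1).2 (Real.summable_one_div_nat_pow.2 one_lt_two)).mul_left 324
  have hmeas : ∀ n, Measurable fun ω => traceDeviation θ (X (n + 1) ω) (P (n + 1) ω) :=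
    fun n => measurable_traceDeviation θ (hX _) (hP _)
  filter_upwards [ae_tendsto_zero_of_lintegral_le hmeas (fun _ _ => traceDeviation_nonneg _ _ _) hc
    fun n => lintegral_traceDeviation_le (hX _) (hP _) (hindep _) (hinv _)
      (hXherm _) hθ (hPv _ n.succ_pos)] with ω hω
  exact (tendsto_add_atTop_iff_nat 1).1 hω

lemma ae_tendsto_traceDeviation_pow (hX : ∀ n, Measurable (X n)) (hP : ∀ n, Measurable (P n))
    (hindep : ∀ n, IndepFun (X n) (P n) Pr)
    (hinv : ∀ n, ConjInvariant Pr (X n) ∨ ConjInvariant Pr (P n))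
    (hXherm : ∀ n ω, (X n ω).IsHermitian) {θ : ℝ} (hθ : θ ≠ 0)
    (hPv : ∀ n, 1 ≤ n → ∀ ω, ∃ v, ∑ i, ‖v i‖ ^ 2 = 1 ∧ P n ω = rankOneMatrix θ v) :
    ∀ᵐ ω ∂Pr, ∀ k, Tendsto (fun n => traceDeviation θ (X n ω ^ k) (P n ω)) atTop (𝓝 0) := by
  refine ae_all_iff.2 fun k => ?_
  have hpow : ∀ n, Measurable fun A : Matrix (Fin n) (Fin n) 𝕜 => A ^ k :=
    fun n => Continuous.measurable (by fun_prop)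
  exact ae_tendsto_traceDeviation (fun n => (hpow n).comp (hX n)) hP
    (fun n => (hindep n).comp (hpow n) measurable_id) (fun n => (hinv n).imp_left (·.pow (hX n) k))
    (fun n ω => (hXherm n ω).pow k) hθ hPv

end AlmostSure

/-! ### The spectral measure of a vector -/

section EigenCoord

open scoped Matrix

variable {𝕜 m : Type*} [RCLike 𝕜] [Fintype m]

lemma star_dotProduct_self (v : m → 𝕜) : star v ⬝ᵥ v = ((∑ i, ‖v i‖ ^ 2 : ℝ) : 𝕜) := by
  simp [dotProduct, RCLike.conj_mul]

variable [DecidableEq m] {A : Matrix m m 𝕜} (hA : A.IsHermitian)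

/-- The coordinates of a vector in the eigenbasis of a Hermitian matrix. -/
noncomputable def eigenCoord : (m → 𝕜) →ₗ[𝕜] m → 𝕜 :=
  (star (hA.eigenvectorUnitary : Matrix m m 𝕜)).mulVecLin

lemma star_dotProduct_eigenCoord (v w : m → 𝕜) :
    star (eigenCoord hA v) ⬝ᵥ eigenCoord hA w = star v ⬝ᵥ w := by
  rw [eigenCoord, Matrix.mulVecLin_apply, Matrix.mulVecLin_apply, Matrix.star_mulVec,
    Matrix.dotProduct_mulVec, Matrix.vecMul_vecMul, ← Matrix.star_eq_conjTranspose, star_star,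
    Unitary.mul_star_self_of_mem hA.eigenvectorUnitary.2, Matrix.vecMul_one]

lemma sum_norm_sq_eigenCoord (w : m → 𝕜) : ∑ i, ‖eigenCoord hA w i‖ ^ 2 = ∑ i, ‖w i‖ ^ 2 := by
  have h := star_dotProduct_eigenCoord hA w w
  rw [star_dotProduct_self, star_dotProduct_self] at h
  exact RCLike.ofReal_injective h

lemma eigenCoord_mulVec (w : m → 𝕜) (i : m) :
    eigenCoord hA (A *ᵥ w) i = (hA.eigenvalues i : 𝕜) * eigenCoord hA w i := by
  have h : star (hA.eigenvectorUnitary : Matrix m m 𝕜) * A =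
      Matrix.diagonal (RCLike.ofReal ∘ hA.eigenvalues) *
        star (hA.eigenvectorUnitary : Matrix m m 𝕜) := by
    have hs := congrArg (star (hA.eigenvectorUnitary : Matrix m m 𝕜) * ·) hA.spectral_theorem
    simp only [Unitary.conjStarAlgAut_apply, ← mul_assoc] at hs
    rwa [Unitary.star_mul_self_of_mem hA.eigenvectorUnitary.2, one_mul] at hs
  rw [eigenCoord, Matrix.mulVecLin_apply, Matrix.mulVecLin_apply, Matrix.mulVec_mulVec, h,
    ← Matrix.mulVec_mulVec, Matrix.mulVec_diagonal, Function.comp_apply]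

lemma eigenCoord_pow_mulVec (w : m → 𝕜) (k : ℕ) (i : m) :
    eigenCoord hA (A ^ k *ᵥ w) i = ((hA.eigenvalues i ^ k : ℝ) : 𝕜) * eigenCoord hA w i := by
  induction k with
  | zero => simp
  | succ k ih =>
    rw [pow_succ', ← Matrix.mulVec_mulVec, eigenCoord_mulVec, ih, pow_succ', RCLike.ofReal_mul,
      mul_assoc]

lemma star_dotProduct_pow_mulVec (w : m → 𝕜) (k : ℕ) :
    star w ⬝ᵥ A ^ k *ᵥ w =
      ((∑ i, ‖eigenCoord hA w i‖ ^ 2 * hA.eigenvalues i ^ k : ℝ) : 𝕜) := by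
  rw [← star_dotProduct_eigenCoord hA]
  simp only [dotProduct, eigenCoord_pow_mulVec, Pi.star_apply, RCLike.star_def, RCLike.ofReal_sum,
    RCLike.ofReal_mul]
  refine Finset.sum_congr rfl fun i _ => ?_
  rw [mul_left_comm, RCLike.conj_mul, mul_comm, RCLike.ofReal_pow ‖_‖]

lemma trace_pow_eq_sum (k : ℕ) : (A ^ k).trace = ((∑ i, hA.eigenvalues i ^ k : ℝ) : 𝕜) := by
  conv_lhs => rw [hA.spectral_theorem]
  rw [← map_pow, Unitary.conjStarAlgAut_apply, Matrix.trace_mul_comm, ← mul_assoc,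
    Unitary.coe_star_mul_self, one_mul, Matrix.diagonal_pow, Matrix.trace_diagonal]
  simp

end EigenCoord

section SpectralConvergence

variable {𝕜 : Type*} [RCLike 𝕜]

lemma tendsto_trace_sub_of_traceDeviation {M B : (n : ℕ) → Matrix (Fin n) (Fin n) 𝕜} {θ C : ℝ}
    (hdev : Tendsto (fun n => traceDeviation θ (M n) (B n)) atTop (𝓝 0))
    (hC : ∀ᶠ n : ℕ in atTop, |RCLike.re (M n * M n).trace / n| ≤ C) :
    Tendsto (fun n => RCLike.re (B n * M n).trace / θ - RCLike.re (M n).trace / n) atTop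
      (𝓝 0) := by
  have hlim : Tendsto (fun n => √√(traceDeviation θ (M n) (B n) * (1 + C ^ 2))) atTop (𝓝 0) := by
    simpa using (hdev.mul_const (1 + C ^ 2)).sqrt.sqrt
  refine squeeze_zero_norm' ?_ hlim
  filter_upwards [hC] with n hn
  refine Real.abs_le_sqrt (Real.le_sqrt_of_sq_le ?_)
  rw [← pow_mul, traceDeviation, Fintype.card_fin, div_mul_eq_mul_div,
    le_div_iff₀ (by positivity)]
  have hsq : (RCLike.re (M n * M n).trace / n) ^ 2 ≤ C ^ 2 :=
    sq_le_sq' (abs_le.1 hn).1 (abs_le.1 hn).2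
  exact mul_le_mul_of_nonneg_left (by linarith) (Even.pow_nonneg (by decide) _)

lemma abs_sum_mul_sub_sum_div_card_le {m : Type*} [Fintype m] {q g : m → ℝ} (hq0 : ∀ i, 0 ≤ q i)
    (hq : ∑ i, q i = 1) {δ : ℝ} (hg : ∀ i, |g i| ≤ δ) :
    |∑ i, q i * g i - (∑ i, g i) / Fintype.card m| ≤ δ + δ := by
  have : Nonempty m := by
    by_contra h
    simp [not_nonempty_iff.1 h] at hq
  have hweighted : |∑ i, q i * g i| ≤ δ :=
    calc _ ≤ ∑ i, |q i * g i| := Finset.abs_sum_le_sum_abs _ _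
      _ ≤ ∑ i, q i * δ := Finset.sum_le_sum fun i _ => by
        rw [abs_mul, abs_of_nonneg (hq0 i)]
        exact mul_le_mul_of_nonneg_left (hg i) (hq0 i)
      _ = δ := by rw [← Finset.sum_mul, hq, one_mul]
  have hmean : |(∑ i, g i) / Fintype.card m| ≤ δ := by
    rw [abs_div, Nat.abs_cast, div_le_iff₀ (by positivity)]
    calc _ ≤ ∑ i, |g i| := Finset.abs_sum_le_sum_abs _ _
      _ ≤ ∑ _i : m, δ := Finset.sum_le_sum fun i _ => hg i
      _ = δ * Fintype.card m := by simp [mul_comm]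
  exact (abs_sub _ _).trans (add_le_add hweighted hmean)

lemma integral_empiricalSpectralMeasure {n : ℕ} {B : Matrix (Fin n) (Fin n) 𝕜}
    (hB : B.IsHermitian) (f : BoundedContinuousFunction ℝ ℝ) :
    ∫ t, f t ∂(empiricalSpectralMeasure hB) = (∑ i, f (hB.eigenvalues i)) / n := by
  rw [empiricalSpectralMeasure, integral_smul_measure,
    integral_finsetSum_measure fun i _ => f.integrable _]
  simp [div_eq_inv_mul]

variable {A : (n : ℕ) → Matrix (Fin n) (Fin n) 𝕜} (hA : ∀ n, (A n).IsHermitian)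
  {v : (n : ℕ) → Fin n → 𝕜} {θ R : ℝ}

include hA in
lemma eventually_abs_trace_pow_mul_self_div_le
    (hR : ∀ᶠ n in atTop, ∀ i, |(hA n).eigenvalues i| ≤ R) (k : ℕ) :
    ∀ᶠ n : ℕ in atTop, |RCLike.re (A n ^ k * A n ^ k).trace / n| ≤ R ^ (k + k) := by
  filter_upwards [hR, eventually_ge_atTop 1] with n hn hn1
  rw [← pow_add, trace_pow_eq_sum (hA n), RCLike.ofReal_re, abs_div, Nat.abs_cast,
    div_le_iff₀ (by positivity)]
  calc _ ≤ ∑ i, |(hA n).eigenvalues i ^ (k + k)| := Finset.abs_sum_le_sum_abs _ _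
    _ ≤ ∑ _i : Fin n, R ^ (k + k) := Finset.sum_le_sum fun i _ => by
      rw [abs_pow]
      exact pow_le_pow_left₀ (abs_nonneg _) (hn i) _
    _ = R ^ (k + k) * n := by simp [mul_comm]

lemma tendsto_sum_mul_pow_sub (hθ : θ ≠ 0)
    (hR : ∀ᶠ n in atTop, ∀ i, |(hA n).eigenvalues i| ≤ R) {k : ℕ}
    (hdev : Tendsto (fun n => traceDeviation θ (A n ^ k) (rankOneMatrix θ (v n))) atTop (𝓝 0)) :
    Tendsto (fun n => ∑ i, ‖eigenCoord (hA n) (v n) i‖ ^ 2 * (hA n).eigenvalues i ^ k -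
      (∑ i, (hA n).eigenvalues i ^ k) / n) atTop (𝓝 0) := by
  refine (tendsto_trace_sub_of_traceDeviation hdev
    (eventually_abs_trace_pow_mul_self_div_le hA hR k)).congr fun n => ?_
  rw [trace_rankOneMatrix_mul, star_dotProduct_pow_mulVec (hA n), trace_pow_eq_sum (hA n),
    ← RCLike.ofReal_mul, RCLike.ofReal_re, RCLike.ofReal_re, mul_div_cancel_left₀ _ hθ]

lemma tendsto_sum_mul_eval_sub (hθ : θ ≠ 0)
    (hR : ∀ᶠ n in atTop, ∀ i, |(hA n).eigenvalues i| ≤ R)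
    (hdev : ∀ k, Tendsto (fun n => traceDeviation θ (A n ^ k) (rankOneMatrix θ (v n))) atTop
      (𝓝 0)) (p : Polynomial ℝ) :
    Tendsto (fun n => ∑ i, ‖eigenCoord (hA n) (v n) i‖ ^ 2 * p.eval ((hA n).eigenvalues i) -
      (∑ i, p.eval ((hA n).eigenvalues i)) / n) atTop (𝓝 0) := by
  have h := tendsto_finsetSum (Finset.range (p.natDegree + 1)) fun k _ =>
    (tendsto_sum_mul_pow_sub hA hθ hR (hdev k)).const_mul (p.coeff k)
  simp only [mul_zero, Finset.sum_const_zero] at h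
  refine h.congr fun n => ?_
  simp_rw [Polynomial.eval_eq_sum_range, mul_sub, Finset.sum_sub_distrib, Finset.mul_sum,
    Finset.sum_div, Finset.mul_sum]
  congr 1
  · rw [Finset.sum_comm]
    exact Finset.sum_congr rfl fun i _ => Finset.sum_congr rfl fun k _ => by ring
  · rw [Finset.sum_comm]
    exact Finset.sum_congr rfl fun i _ => Finset.sum_congr rfl fun k _ => by ring

lemma tendsto_sum_mul_sub (hθ : θ ≠ 0) (hv : ∀ᶠ n in atTop, ∑ i, ‖v n i‖ ^ 2 = 1)
    (hR : ∀ᶠ n in atTop, ∀ i, |(hA n).eigenvalues i| ≤ R)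
    (hdev : ∀ k, Tendsto (fun n => traceDeviation θ (A n ^ k) (rankOneMatrix θ (v n))) atTop
      (𝓝 0)) {f : ℝ → ℝ} (hf : Continuous f) :
    Tendsto (fun n => ∑ i, ‖eigenCoord (hA n) (v n) i‖ ^ 2 * f ((hA n).eigenvalues i) -
      (∑ i, f ((hA n).eigenvalues i)) / n) atTop (𝓝 0) := by
  refine Metric.tendsto_nhds.2 fun ε hε => ?_
  obtain ⟨p, hp⟩ := exists_polynomial_near_of_continuousOn (-R) R f hf.continuousOn
    (ε / 3) (by positivity)
  filter_upwards [Metric.tendsto_nhds.1 (tendsto_sum_mul_eval_sub hA hθ hR hdev p) (ε / 3)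
    (by positivity), hR, hv] with n hpoly hRn hvn
  rw [dist_zero_right, Real.norm_eq_abs] at hpoly ⊢
  have hq : ∑ i, ‖eigenCoord (hA n) (v n) i‖ ^ 2 = 1 :=
    (sum_norm_sq_eigenCoord (hA n) (v n)).trans hvn
  have happrox := abs_sum_mul_sub_sum_div_card_le (fun i => sq_nonneg _) hq
    (g := fun i => f ((hA n).eigenvalues i) - p.eval ((hA n).eigenvalues i)) fun i => by
      rw [abs_sub_comm]
      exact (hp _ (abs_le.1 (hRn i))).le
  simp only [mul_sub, Finset.sum_sub_distrib, Fintype.card_fin, sub_div] at happrox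
  rw [abs_lt] at hpoly ⊢
  rw [abs_le] at happrox
  constructor <;> linarith [hpoly.1, hpoly.2, happrox.1, happrox.2]

lemma tendsto_sum_mul_integral (hθ : θ ≠ 0) (hv : ∀ᶠ n in atTop, ∑ i, ‖v n i‖ ^ 2 = 1)
    (hR : ∀ᶠ n in atTop, ∀ i, |(hA n).eigenvalues i| ≤ R)
    (hdev : ∀ k, Tendsto (fun n => traceDeviation θ (A n ^ k) (rankOneMatrix θ (v n))) atTop
      (𝓝 0)) {μ : Measure ℝ}
    (hweak : WeaklyConverges (fun n => empiricalSpectralMeasure (hA n)) μ)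
    (f : BoundedContinuousFunction ℝ ℝ) :
    Tendsto (fun n => ∑ i, ‖eigenCoord (hA n) (v n) i‖ ^ 2 * f ((hA n).eigenvalues i)) atTop
      (𝓝 (∫ t, f t ∂μ)) := by
  have hlim := hweak f
  simp only [integral_empiricalSpectralMeasure] at hlim
  simpa using (tendsto_sum_mul_sub hA hθ hv hR hdev f.continuous).add hlim

end SpectralConvergence

/-! ### Eigenvalues of rank one perturbations -/

section RealEigenvalues

open scoped Matrix

variable {𝕜 : Type*} [RCLike 𝕜] {n : ℕ} {A B : Matrix (Fin n) (Fin n) 𝕜} {t : ℝ}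

lemma mem_realEigenvalues_iff :
    t ∈ realEigenvalues A ↔ ∃ v : Fin n → 𝕜, ∑ i, ‖v i‖ ^ 2 = 1 ∧ A *ᵥ v = (t : 𝕜) • v := by
  constructor
  · intro ht
    obtain ⟨x, hx⟩ := Module.End.HasEigenvalue.exists_hasEigenvector ht
    have hx0 : ‖x‖ ≠ 0 := norm_ne_zero_iff.2 hx.2
    have hAx : A *ᵥ x.ofLp = (t : 𝕜) • x.ofLp := congrArg WithLp.ofLp hx.apply_eq_smul
    refine ⟨((‖x‖⁻¹ : ℝ) : 𝕜) • x.ofLp, ?_, by rw [Matrix.mulVec_smul, hAx, smul_comm]⟩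
    simp only [Pi.smul_apply, smul_eq_mul, norm_mul, RCLike.norm_ofReal, mul_pow, sq_abs,
      ← Finset.mul_sum, ← EuclideanSpace.norm_sq_eq x]
    field_simp
  · rintro ⟨v, hv, hAv⟩
    have hv0 : v ≠ 0 := by
      rintro rfl
      simp at hv
    exact Module.End.hasEigenvalue_of_hasEigenvector (x := WithLp.toLp 2 v)
      ⟨Module.End.mem_eigenspace_iff.2 (congrArg (WithLp.toLp 2) hAv), by simpa using hv0⟩

lemma finite_realEigenvalues (A : Matrix (Fin n) (Fin n) 𝕜) : (realEigenvalues A).Finite :=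
  (Module.End.finite_hasEigenvalue (Matrix.toEuclideanLin A)).preimage
    (RCLike.ofReal_injective (K := 𝕜)).injOn

lemma realEigenvalues_mul_comm (A B : Matrix (Fin n) (Fin n) 𝕜) :
    realEigenvalues (A * B) = realEigenvalues (B * A) := by
  have hroot : ∀ (C : Matrix (Fin n) (Fin n) 𝕜) (t : ℝ),
      t ∈ realEigenvalues C ↔ C.charpoly.IsRoot (t : 𝕜) := fun C t => by
    rw [realEigenvalues, Set.mem_ofPred_eq, Module.End.hasEigenvalue_iff_isRoot_charpoly,
      Matrix.toEuclideanLin, Matrix.toLpLin_eq_toLin, Matrix.charpoly_toLin]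
  ext t
  rw [hroot, hroot, Matrix.charpoly_mul_comm]

lemma eigenvalues_mem_realEigenvalues (hA : A.IsHermitian) (i : Fin n) :
    hA.eigenvalues i ∈ realEigenvalues A := by
  refine mem_realEigenvalues_iff.2 ⟨(hA.eigenvectorBasis i).ofLp, ?_, ?_⟩
  · rw [← EuclideanSpace.norm_sq_eq, hA.eigenvectorBasis.norm_eq_one, one_pow]
  · rw [hA.mulVec_eigenvectorBasis]
    ext j
    simp [RCLike.real_smul_eq_coe_mul]

lemma le_maxEigenvalue (ht : t ∈ realEigenvalues A) : t ≤ maxEigenvalue A :=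
  le_csSup (finite_realEigenvalues A).bddAbove ht

lemma minEigenvalue_le (ht : t ∈ realEigenvalues A) : minEigenvalue A ≤ t :=
  csInf_le (finite_realEigenvalues A).bddBelow ht

lemma nonneg_of_mem_realEigenvalues (hA : A.PosSemidef) (ht : t ∈ realEigenvalues A) : 0 ≤ t := by
  obtain ⟨v, hv, hAv⟩ := mem_realEigenvalues_iff.1 ht
  have h := hA.re_dotProduct_nonneg v
  rwa [hAv, dotProduct_smul, star_dotProduct_self, hv, smul_eq_mul, RCLike.re_ofReal_mul,
    RCLike.ofReal_one, RCLike.one_re, mul_one] at h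

lemma re_dotProduct_mulVec_eq_sum (hA : A.IsHermitian) (w : Fin n → 𝕜) :
    RCLike.re (star w ⬝ᵥ A *ᵥ w) = ∑ i, ‖eigenCoord hA w i‖ ^ 2 * hA.eigenvalues i := by
  have h := star_dotProduct_pow_mulVec hA w 1
  simp only [pow_one] at h
  rw [h, RCLike.ofReal_re]

lemma re_dotProduct_mulVec_le_maxEigenvalue (hA : A.IsHermitian) {w : Fin n → 𝕜}
    (hw : ∑ i, ‖w i‖ ^ 2 = 1) : RCLike.re (star w ⬝ᵥ A *ᵥ w) ≤ maxEigenvalue A := by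
  rw [re_dotProduct_mulVec_eq_sum hA, ← one_mul (maxEigenvalue A), ← hw,
    ← sum_norm_sq_eigenCoord hA w, Finset.sum_mul]
  gcongr
  exact le_maxEigenvalue (eigenvalues_mem_realEigenvalues hA _)

lemma minEigenvalue_le_re_dotProduct_mulVec (hA : A.IsHermitian) {w : Fin n → 𝕜}
    (hw : ∑ i, ‖w i‖ ^ 2 = 1) : minEigenvalue A ≤ RCLike.re (star w ⬝ᵥ A *ᵥ w) := by
  rw [re_dotProduct_mulVec_eq_sum hA, ← one_mul (minEigenvalue A), ← hw,
    ← sum_norm_sq_eigenCoord hA w, Finset.sum_mul]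
  gcongr
  exact minEigenvalue_le (eigenvalues_mem_realEigenvalues hA _)

variable [NeZero n]

lemma maxEigenvalue_le_of_posSemidef_sub (hA : A.IsHermitian) (hB : B.IsHermitian)
    (hAB : (B - A).PosSemidef) : maxEigenvalue A ≤ maxEigenvalue B := by
  obtain ⟨w, hw, hAw⟩ := mem_realEigenvalues_iff.1 <|
    Set.Nonempty.csSup_mem ⟨_, eigenvalues_mem_realEigenvalues hA 0⟩ (finite_realEigenvalues A)
  have hquad : RCLike.re (star w ⬝ᵥ A *ᵥ w) = maxEigenvalue A := by
    rw [hAw, dotProduct_smul, star_dotProduct_self, hw]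
    simp [maxEigenvalue]
  have hsub := hAB.re_dotProduct_nonneg w
  rw [Matrix.sub_mulVec, dotProduct_sub, map_sub] at hsub
  linarith [re_dotProduct_mulVec_le_maxEigenvalue hB hw]

lemma minEigenvalue_le_of_posSemidef_sub (hA : A.IsHermitian) (hB : B.IsHermitian)
    (hAB : (B - A).PosSemidef) : minEigenvalue A ≤ minEigenvalue B := by
  obtain ⟨w, hw, hBw⟩ := mem_realEigenvalues_iff.1 <|
    Set.Nonempty.csInf_mem ⟨_, eigenvalues_mem_realEigenvalues hB 0⟩ (finite_realEigenvalues B)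
  have hquad : RCLike.re (star w ⬝ᵥ B *ᵥ w) = minEigenvalue B := by
    rw [hBw, dotProduct_smul, star_dotProduct_self, hw]
    simp [minEigenvalue]
  have hsub := hAB.re_dotProduct_nonneg w
  rw [Matrix.sub_mulVec, dotProduct_sub, map_sub] at hsub
  linarith [minEigenvalue_le_re_dotProduct_mulVec hA hw]

end RealEigenvalues

section RankOne

open scoped Matrix

variable {𝕜 : Type*} [RCLike 𝕜] {n : ℕ} {θ : ℝ}

lemma posSemidef_rankOneMatrix {m : Type*} [Finite m] (hθ : 0 ≤ θ) (v : m → 𝕜) :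
    (rankOneMatrix θ v).PosSemidef :=
  (Matrix.posSemidef_vecMulVec_self_star v).smul (by exact_mod_cast hθ)

open scoped MatrixOrder in
lemma exists_realEigenvalues_mul_one_add_rankOneMatrix_eq {A : Matrix (Fin n) (Fin n) 𝕜}
    (hA : A.PosSemidef) : ∃ B : Matrix (Fin n) (Fin n) 𝕜,
      realEigenvalues A = realEigenvalues (B * Bᴴ) ∧ ∀ (θ : ℝ) (v : Fin n → 𝕜),
        realEigenvalues (A * (1 + rankOneMatrix θ v)) =
          realEigenvalues (B * Bᴴ + rankOneMatrix θ (B *ᵥ v)) := by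
  obtain ⟨B, rfl⟩ := CStarAlgebra.nonneg_iff_eq_star_mul_self.1 hA.nonneg
  refine ⟨B, realEigenvalues_mul_comm _ _, fun θ v => ?_⟩
  rw [mul_assoc, realEigenvalues_mul_comm, mul_add, mul_one, add_mul,
    Matrix.star_eq_conjTranspose, mul_rankOneMatrix_mul_conjTranspose]

lemma maxEigenvalue_le_mul_one_add_rankOneMatrix [NeZero n] {A : Matrix (Fin n) (Fin n) 𝕜}
    (hA : A.PosSemidef) (hθ : 0 ≤ θ) (v : Fin n → 𝕜) :
    maxEigenvalue A ≤ maxEigenvalue (A * (1 + rankOneMatrix θ v)) := by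
  obtain ⟨B, hB, hBv⟩ := exists_realEigenvalues_mul_one_add_rankOneMatrix_eq hA
  have hpos := posSemidef_rankOneMatrix hθ (B *ᵥ v)
  have hBB := Matrix.isHermitian_mul_conjTranspose_self B
  have h := maxEigenvalue_le_of_posSemidef_sub hBB (hBB.add hpos.isHermitian)
    (by rwa [add_sub_cancel_left])
  rwa [maxEigenvalue, maxEigenvalue, hB, hBv θ v]

lemma rankOneMatrix_neg {m : Type*} (θ : ℝ) (v : m → 𝕜) :
    rankOneMatrix (-θ) v = -rankOneMatrix θ v := by
  rw [rankOneMatrix, RCLike.ofReal_neg, neg_smul, rankOneMatrix]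

lemma minEigenvalue_mul_one_add_rankOneMatrix_le [NeZero n] {A : Matrix (Fin n) (Fin n) 𝕜}
    (hA : A.PosSemidef) (hθ : θ ≤ 0) (v : Fin n → 𝕜) :
    minEigenvalue (A * (1 + rankOneMatrix θ v)) ≤ minEigenvalue A := by
  obtain ⟨B, hB, hBv⟩ := exists_realEigenvalues_mul_one_add_rankOneMatrix_eq hA
  have hpos := posSemidef_rankOneMatrix (neg_nonneg.2 hθ) (B *ᵥ v)
  rw [rankOneMatrix_neg] at hpos
  have hBB := Matrix.isHermitian_mul_conjTranspose_self B
  have h := minEigenvalue_le_of_posSemidef_sub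
    (hBB.add (neg_neg (rankOneMatrix θ (B *ᵥ v)) ▸ hpos.isHermitian.neg)) hBB
    (by rwa [sub_add_cancel_left])
  rwa [minEigenvalue, minEigenvalue, hB, hBv θ v]

lemma exists_eq_rankOneMatrix {P : Matrix (Fin n) (Fin n) 𝕜} (hP : P.IsHermitian)
    (hrank : P.rank = 1) (hθ : θ ≠ 0) (heig : θ ∈ realEigenvalues P) :
    ∃ v : Fin n → 𝕜, ∑ i, ‖v i‖ ^ 2 = 1 ∧ P = rankOneMatrix θ v := by
  obtain ⟨v, hv, hPv⟩ := mem_realEigenvalues_iff.1 heig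
  refine ⟨v, hv, Matrix.ext_of_mulVec_single fun j => ?_⟩
  set x : Fin n → 𝕜 := Pi.single j 1
  have hθ' : (θ : 𝕜) ≠ 0 := by exact_mod_cast hθ
  have hvmem : v ∈ LinearMap.range P.mulVecLin :=
    ⟨(θ : 𝕜)⁻¹ • v, by
      rw [Matrix.mulVecLin_apply, Matrix.mulVec_smul, hPv, smul_smul, inv_mul_cancel₀ hθ',
        one_smul]⟩
  have hv0 : v ≠ 0 := by
    rintro rfl
    simp at hv
  obtain ⟨c, hc⟩ : ∃ c : 𝕜, c • v = P *ᵥ x := by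
    obtain ⟨c, hc⟩ := (finrank_eq_one_iff_of_nonzero' (⟨v, hvmem⟩ : LinearMap.range P.mulVecLin)
      (by simpa using hv0)).1 hrank ⟨P *ᵥ x, ⟨x, rfl⟩⟩
    exact ⟨c, congrArg Subtype.val hc⟩
  have hvP : star v ᵥ* P = (θ : 𝕜) • star v := by
    have h := congrArg star hPv
    rw [Matrix.star_mulVec, hP.eq] at h
    simpa using h
  have hcoeff : star v ⬝ᵥ P *ᵥ x = θ * (star v ⬝ᵥ x) := by
    rw [Matrix.dotProduct_mulVec, hvP, smul_dotProduct, smul_eq_mul]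
  rw [← hc, dotProduct_smul, star_dotProduct_self, hv, RCLike.ofReal_one, smul_eq_mul,
    mul_one] at hcoeff
  rw [← hc, hcoeff, rankOneMatrix_mulVec]

lemma kerShift_rankOneMatrix (hθ : θ ≠ 0) {v : Fin n → 𝕜} (hv : ∑ i, ‖v i‖ ^ 2 = 1) :
    kerShift θ (rankOneMatrix θ v) = Submodule.span 𝕜 {WithLp.toLp 2 v} := by
  have hθ' : (θ : 𝕜) ≠ 0 := by exact_mod_cast hθ
  have hmul : ∀ x : Fin n → 𝕜,
      ((θ : 𝕜) • (1 : Matrix (Fin n) (Fin n) 𝕜) - rankOneMatrix θ v) *ᵥ x =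
        (θ : 𝕜) • (x - (star v ⬝ᵥ x) • v) := fun x => by
    rw [Matrix.sub_mulVec, Matrix.smul_mulVec, Matrix.one_mulVec, rankOneMatrix_mulVec, smul_sub,
      smul_smul]
  ext x
  rw [kerShift, LinearMap.mem_ker, Submodule.mem_span_singleton, Matrix.toLpLin_apply, hmul,
    WithLp.toLp_eq_zero, smul_eq_zero_iff_right hθ', sub_eq_zero]
  constructor
  · exact fun h => ⟨star v ⬝ᵥ x.ofLp, by rw [← WithLp.toLp_smul, ← h]⟩
  · rintro ⟨d, rfl⟩
    simp [dotProduct_smul, star_dotProduct_self, hv]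

lemma projNorm_kerShift_rankOneMatrix (hθ : θ ≠ 0) {v : Fin n → 𝕜} (hv : ∑ i, ‖v i‖ ^ 2 = 1)
    (u : EuclideanSpace 𝕜 (Fin n)) :
    projNorm u (kerShift θ (rankOneMatrix θ v)) = ‖star v ⬝ᵥ u.ofLp‖ := by
  have hnorm : ‖WithLp.toLp 2 v‖ = 1 := by simp [EuclideanSpace.norm_eq, hv]
  rw [projNorm, kerShift_rankOneMatrix hθ hv, Submodule.starProjection_unit_singleton 𝕜 hnorm,
    norm_smul, hnorm, mul_one, EuclideanSpace.inner_eq_star_dotProduct, dotProduct_comm]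

end RankOne

/-! ### The T-transform near an edge -/

section TTransform

variable {ν : Measure ℝ} {α β z z' : ℝ}

lemma abs_div_sub_le {r t : ℝ} (hr : 0 < r) (h : r ≤ |z - t|) : |t / (z - t)| ≤ 1 + |z| / r := by
  have hzt : z - t ≠ 0 := abs_pos.1 (hr.trans_le h)
  calc |t / (z - t)| = |z / (z - t) - 1| := by rw [div_sub_one hzt, sub_sub_cancel]
    _ ≤ |z / (z - t)| + |(1 : ℝ)| := abs_sub _ _
    _ ≤ 1 + |z| / r := by
      rw [abs_one, abs_div, add_comm]
      gcongr

lemma div_sub_sub_div_sub {t : ℝ} (hz : z - t ≠ 0) (hz' : z' - t ≠ 0) :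
    t / (z - t) - t / (z' - t) = t * ((z' - z) / ((z - t) * (z' - t))) := by
  field_simp
  ring

lemma integrable_div_sub [IsFiniteMeasure ν] {r : ℝ} (hr : 0 < r)
    (h : ∀ᵐ t ∂ν, r ≤ |z - t|) : Integrable (fun t => t / (z - t)) ν :=
  .of_bound (by fun_prop : Measurable _).aestronglyMeasurable (1 + |z| / r)
    (h.mono fun _ ht => abs_div_sub_le hr ht)

lemma ae_le_abs_sub_of_gt (hβ : ∀ᵐ t ∂ν, t ≤ β) (hz : β < z) : ∀ᵐ t ∂ν, z - β ≤ |z - t| :=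
  hβ.mono fun t ht => by rw [abs_of_pos] <;> linarith

lemma ae_le_abs_sub_of_lt (hα : ∀ᵐ t ∂ν, α ≤ t) (hz : z < α) : ∀ᵐ t ∂ν, α - z ≤ |z - t| :=
  hα.mono fun t ht => by rw [abs_of_neg] <;> linarith

lemma integrable_div_sub_of_gt [IsFiniteMeasure ν] (hβ : ∀ᵐ t ∂ν, t ≤ β) (hz : β < z) :
    Integrable (fun t => t / (z - t)) ν :=
  integrable_div_sub (sub_pos.2 hz) (ae_le_abs_sub_of_gt hβ hz)

lemma integrable_div_sub_of_lt [IsFiniteMeasure ν] (hα : ∀ᵐ t ∂ν, α ≤ t) (hz : z < α) :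
    Integrable (fun t => t / (z - t)) ν :=
  integrable_div_sub (sub_pos.2 hz) (ae_le_abs_sub_of_lt hα hz)

lemma tTransform_lt_tTransform (hz : Integrable (fun t => t / (z - t)) ν)
    (hz' : Integrable (fun t => t / (z' - t)) ν) (hpos : ∀ᵐ t ∂ν, 0 ≤ t)
    (hne : ¬ ∀ᵐ t ∂ν, t = 0) (hsep : ∀ᵐ t ∂ν, 0 < (z - t) * (z' - t)) (hzz' : z < z') :
    tTransform ν z' < tTransform ν z := by
  have hdiff : ∀ᵐ t ∂ν, t / (z - t) - t / (z' - t) = t * ((z' - z) / ((z - t) * (z' - t))) :=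
    hsep.mono fun t ht =>
      div_sub_sub_div_sub (left_ne_zero_of_mul ht.ne') (right_ne_zero_of_mul ht.ne')
  have hnonneg : 0 ≤ᵐ[ν] fun t => t / (z - t) - t / (z' - t) := by
    filter_upwards [hdiff, hpos, hsep] with t heq ht hprod
    rw [Pi.zero_apply, heq]
    exact mul_nonneg ht (div_nonneg (sub_nonneg.2 hzz'.le) hprod.le)
  have hlt : 0 < ∫ t, (t / (z - t) - t / (z' - t)) ∂ν := by
    refine (integral_nonneg_of_ae hnonneg).lt_of_ne' fun hzero => hne ?_
    filter_upwards [(integral_eq_zero_iff_of_nonneg_ae hnonneg (hz.sub hz')).1 hzero, hdiff, hsep]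
      with t ht heq hprod
    rw [heq, Pi.zero_apply] at ht
    exact (mul_eq_zero.1 ht).resolve_right (div_pos (sub_pos.2 hzz') hprod).ne'
  rwa [integral_sub hz hz', sub_pos] at hlt

lemma strictAntiOn_tTransform_Ioi [IsFiniteMeasure ν] (hβ : ∀ᵐ t ∂ν, t ≤ β)
    (hpos : ∀ᵐ t ∂ν, 0 ≤ t) (hne : ¬ ∀ᵐ t ∂ν, t = 0) :
    StrictAntiOn (tTransform ν) (Set.Ioi β) := fun _ hz _ hz' hzz' =>
  tTransform_lt_tTransform (integrable_div_sub_of_gt hβ hz) (integrable_div_sub_of_gt hβ hz')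
    hpos hne (hβ.mono fun _ ht =>
      mul_pos (sub_pos.2 (ht.trans_lt hz)) (sub_pos.2 (ht.trans_lt hz'))) hzz'

lemma strictAntiOn_tTransform_Iio [IsFiniteMeasure ν] (hα : ∀ᵐ t ∂ν, α ≤ t)
    (hpos : ∀ᵐ t ∂ν, 0 ≤ t) (hne : ¬ ∀ᵐ t ∂ν, t = 0) :
    StrictAntiOn (tTransform ν) (Set.Iio α) := fun _ hz _ hz' hzz' =>
  tTransform_lt_tTransform (integrable_div_sub_of_lt hα hz) (integrable_div_sub_of_lt hα hz')
    hpos hne (hα.mono fun _ ht => mul_pos_of_neg_of_neg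
      (sub_neg.2 (lt_of_lt_of_le hz ht)) (sub_neg.2 (lt_of_lt_of_le hz' ht))) hzz'

end TTransform

section DivergentDerivative

variable {ν : Measure ℝ} {β z z' : ℝ}

lemma integrable_div_sub_sq [IsFiniteMeasure ν] (hβ : ∀ᵐ t ∂ν, t ≤ β) (hz : β < z) :
    Integrable (fun t => (t / (z - t)) ^ 2) ν := by
  refine .of_bound (by fun_prop : Measurable _).aestronglyMeasurable ((1 + |z| / (z - β)) ^ 2) ?_
  filter_upwards [ae_le_abs_sub_of_gt hβ hz] with t ht
  rw [norm_pow]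
  exact pow_le_pow_left₀ (norm_nonneg _) (abs_div_sub_le (sub_pos.2 hz) ht) 2

lemma abs_div_sq_le {t : ℝ} (hβ : β ≠ 0) (ht : t ≤ β) (hz : β < z) :
    |t| / (z - t) ^ 2 ≤ 2 / |β| * ((t / (z - t)) ^ 2 + 1) := by
  have hzt : 0 < z - t := sub_pos.2 (ht.trans_lt hz)
  have := abs_pos.2 hβ
  have hle : |β| ≤ |t| + (z - t) := by
    rw [abs_le]
    constructor <;> linarith [neg_abs_le t, le_abs_self t]
  rw [div_pow, div_add_one (by positivity), div_mul_div_comm,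
    div_le_div_iff₀ (by positivity) (by positivity)]
  have hmul : |t| * |β| ≤ 2 * (t ^ 2 + (z - t) ^ 2) := by
    rw [← sq_abs t]
    nlinarith [mul_le_mul_of_nonneg_left hle (abs_nonneg t), sq_nonneg (|t| - (z - t))]
  nlinarith [mul_le_mul_of_nonneg_right hmul (sq_nonneg (z - t))]

lemma abs_tTransform_sub_le [IsProbabilityMeasure ν] (hβ : ∀ᵐ t ∂ν, t ≤ β) (hβ0 : β ≠ 0)
    (hz : β < z) (hz' : β < z') :
    |tTransform ν z - tTransform ν z'| ≤
      |z - z'| *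
        (2 / |β| * ((∫ t, (t / (z - t)) ^ 2 ∂ν + ∫ t, (t / (z' - t)) ^ 2 ∂ν) / 2 + 1)) := by
  have hi := integrable_div_sub_sq hβ hz
  have hi' := integrable_div_sub_sq hβ hz'
  have hpointwise : ∀ᵐ t ∂ν, ‖t / (z - t) - t / (z' - t)‖ ≤
      |z - z'| * (2 / |β| * (((t / (z - t)) ^ 2 + (t / (z' - t)) ^ 2) / 2 + 1)) := by
    filter_upwards [hβ] with t ht
    have hzt : 0 < z - t := sub_pos.2 (ht.trans_lt hz)
    have hzt' : 0 < z' - t := sub_pos.2 (ht.trans_lt hz')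
    have hamgm : |t| / ((z - t) * (z' - t)) ≤
        (|t| / (z - t) ^ 2 + |t| / (z' - t) ^ 2) / 2 := by
      simp only [div_eq_mul_inv, mul_inv, ← inv_pow]
      nlinarith [mul_nonneg (abs_nonneg t) (sq_nonneg ((z - t)⁻¹ - (z' - t)⁻¹))]
    calc ‖t / (z - t) - t / (z' - t)‖ = |z - z'| * (|t| / ((z - t) * (z' - t))) := by
          rw [div_sub_sub_div_sub hzt.ne' hzt'.ne', Real.norm_eq_abs, abs_mul, abs_div,
            abs_of_pos (mul_pos hzt hzt'), abs_sub_comm z' z]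
          ring
      _ ≤ _ := by
        gcongr
        linarith [abs_div_sq_le hβ0 ht hz, abs_div_sq_le hβ0 ht hz']
  rw [tTransform, tTransform, ← integral_sub (integrable_div_sub_of_gt hβ hz)
    (integrable_div_sub_of_gt hβ hz')]
  refine (norm_integral_le_of_norm_le (((((hi.add hi').div_const 2).add
    (integrable_const 1)).const_mul _).const_mul _) hpointwise).trans_eq ?_
  rw [integral_const_mul, integral_const_mul,
    integral_add' ((hi.add hi').div_const 2) (integrable_const 1), integral_div,
    integral_add' hi hi', integral_const, probReal_univ, one_smul]

lemma exists_lt_integral_div_sub_sq [IsProbabilityMeasure ν] (hβ : ∀ᵐ t ∂ν, t ≤ β)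
    (hβ0 : β ≠ 0) (hderiv : Tendsto (fun z => |deriv (tTransform ν) z|) (𝓝[>] β) atTop) (K : ℝ) :
    ∃ z > β, K < ∫ t, (t / (z - t)) ^ 2 ∂ν := by
  by_contra! hK
  have hlip : LipschitzOnWith (2 / |β| * (K + 1)).toNNReal (tTransform ν) (Set.Ioi β) := by
    refine LipschitzOnWith.of_dist_le_mul fun z hz z' hz' => ?_
    rw [Real.dist_eq, Real.dist_eq, mul_comm]
    refine (abs_tTransform_sub_le hβ hβ0 hz hz').trans ?_
    gcongr
    refine le_trans ?_ (Real.le_coe_toNNReal _)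
    gcongr
    linarith [hK z hz, hK z' hz']
  obtain ⟨z, hz, hzβ⟩ := ((hderiv.eventually_gt_atTop _).and self_mem_nhdsWithin).exists
  exact (norm_deriv_le_of_lipschitzOn (Ioi_mem_nhds hzβ) hlip).not_gt hz

end DivergentDerivative

section Reflection

variable {ν : Measure ℝ} {α : ℝ}

lemma tTransform_map_neg (ν : Measure ℝ) (z : ℝ) :
    tTransform (ν.map Neg.neg) z = tTransform ν (-z) := by
  rw [tTransform, tTransform, measurableEmbedding_neg.integral_map]
  congr 1 with t
  rw [← neg_div_neg_eq]
  congr 1 <;> ring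

lemma ae_map_neg_le (hα : ∀ᵐ t ∂ν, α ≤ t) : ∀ᵐ t ∂ν.map Neg.neg, t ≤ -α :=
  measurableEmbedding_neg.ae_map_iff.2 (hα.mono fun _ => neg_le_neg)

lemma tendsto_abs_deriv_tTransform_map_neg
    (h : Tendsto (deriv (tTransform ν)) (𝓝[<] α) atBot) :
    Tendsto (fun z => |deriv (tTransform (ν.map Neg.neg)) z|) (𝓝[>] (-α)) atTop := by
  have hlim : Tendsto Neg.neg (𝓝[>] (-α)) (𝓝[<] α) := by
    simpa only [neg_neg] using tendsto_neg_nhdsGT (a := -α)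
  simp_rw [funext (tTransform_map_neg ν), deriv_comp_neg, abs_neg]
  exact tendsto_abs_atBot_atTop.comp (h.comp hlim)

end Reflection

section Subcritical

lemma lt_of_strictAntiOn_of_tendsto_nhdsGT {E : Type*} [LinearOrder E] [TopologicalSpace E]
    [OrderClosedTopology E] {f : ℝ → E} {β z : ℝ} {L : E} (hf : StrictAntiOn f (Set.Ioi β))
    (hL : Tendsto f (𝓝[>] β) (𝓝 L)) (hz : β < z) : f z < L := by
  obtain ⟨w, hβw, hwz⟩ := exists_between hz
  refine (hf hβw hz hwz).trans_le (ge_of_tendsto hL ?_)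
  filter_upwards [Ioo_mem_nhdsGT hβw] with x hx
  exact (hf hx.1 hβw hx.2).le

lemma lt_of_strictAntiOn_of_tendsto_nhdsLT {E : Type*} [LinearOrder E] [TopologicalSpace E]
    [OrderClosedTopology E] {f : ℝ → E} {α z : ℝ} {L : E} (hf : StrictAntiOn f (Set.Iio α))
    (hL : Tendsto f (𝓝[<] α) (𝓝 L)) (hz : z < α) : L < f z := by
  obtain ⟨w, hzw, hwα⟩ := exists_between hz
  refine (le_of_tendsto hL ?_).trans_lt (hf hz hwα hzw)
  filter_upwards [Ioo_mem_nhdsLT hwα] with x hx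
  exact (hf hwα hx.2 hx.1).le

variable {μ : Measure ℝ} {a b θ z : ℝ} {Ta Tb : EReal}

lemma not_ae_eq_zero [IsProbabilityMeasure μ] (hμ : μ ≠ Measure.dirac 0) : ¬ ∀ᵐ t ∂μ, t = 0 := by
  intro h
  have hmap : μ.map id = μ.map fun _ => (0 : ℝ) := Measure.map_congr h
  rw [Measure.map_id, Measure.map_const, measure_univ, one_smul] at hmap
  exact hμ hmap

lemma tTransform_limit_nonpos (ha : ∀ᵐ t ∂μ, a ≤ t) (hpos : ∀ᵐ t ∂μ, 0 ≤ t)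
    (hTa : Tendsto (fun z => (tTransform μ z : EReal)) (𝓝[<] a) (𝓝 Ta)) : Ta ≤ 0 := by
  refine le_of_tendsto hTa ?_
  filter_upwards [self_mem_nhdsWithin] with z hz
  rw [← EReal.coe_zero, EReal.coe_le_coe_iff]
  refine integral_nonpos_of_ae ?_
  filter_upwards [ha, hpos] with t hat ht
  exact div_nonpos_of_nonneg_of_nonpos ht (sub_nonpos.2 (hz.out.le.trans hat))

lemma tTransform_limit_nonneg (hb : ∀ᵐ t ∂μ, t ≤ b) (hpos : ∀ᵐ t ∂μ, 0 ≤ t)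
    (hTb : Tendsto (fun z => (tTransform μ z : EReal)) (𝓝[>] b) (𝓝 Tb)) : 0 ≤ Tb := by
  refine ge_of_tendsto hTb ?_
  filter_upwards [self_mem_nhdsWithin] with z hz
  rw [← EReal.coe_zero, EReal.coe_le_coe_iff]
  refine integral_nonneg_of_ae ?_
  filter_upwards [hb, hpos] with t hbt ht
  exact div_nonneg ht (sub_nonneg.2 (hbt.trans hz.out.le))

variable [IsProbabilityMeasure μ] (ha : ∀ᵐ t ∂μ, a ≤ t) (hb : ∀ᵐ t ∂μ, t ≤ b)
  (hpos : ∀ᵐ t ∂μ, 0 ≤ t) (hμ : μ ≠ Measure.dirac 0)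
  (hTa : Tendsto (fun z => (tTransform μ z : EReal)) (𝓝[<] a) (𝓝 Ta))
  (hTb : Tendsto (fun z => (tTransform μ z : EReal)) (𝓝[>] b) (𝓝 Tb))
  (hsub : ((1 / θ : ℝ) : EReal) ∉ Set.Ioo Ta Tb)

include ha hb hpos hμ hTa hTb hsub

lemma mul_tTransform_lt_one_of_pos (hθ : 0 < θ) (hz : b < z) : θ * tTransform μ z < 1 := by
  have hTa0 : Ta < (1 / θ : ℝ) :=
    (tTransform_limit_nonpos ha hpos hTa).trans_lt (EReal.coe_pos.2 (one_div_pos.2 hθ))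
  have hTbθ : Tb ≤ (1 / θ : ℝ) := not_lt.1 fun h => hsub ⟨hTa0, h⟩
  have hanti : StrictAntiOn (fun z => (tTransform μ z : EReal)) (Set.Ioi b) :=
    EReal.coe_strictMono.comp_strictAntiOn
      (strictAntiOn_tTransform_Ioi hb hpos (not_ae_eq_zero hμ))
  have hlt : tTransform μ z < 1 / θ := EReal.coe_lt_coe_iff.1 <|
    (lt_of_strictAntiOn_of_tendsto_nhdsGT hanti hTb hz).trans_le hTbθ
  rwa [lt_div_iff₀' hθ] at hlt

lemma mul_tTransform_lt_one_of_neg (hθ : θ < 0) (hz : z < a) : θ * tTransform μ z < 1 := by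
  have hTb0 : ((1 / θ : ℝ) : EReal) < Tb :=
    lt_of_lt_of_le (by exact_mod_cast one_div_neg.2 hθ) (tTransform_limit_nonneg hb hpos hTb)
  have hTaθ : ((1 / θ : ℝ) : EReal) ≤ Ta := not_lt.1 fun h => hsub ⟨h, hTb0⟩
  have hanti : StrictAntiOn (fun z => (tTransform μ z : EReal)) (Set.Iio a) :=
    EReal.coe_strictMono.comp_strictAntiOn
      (strictAntiOn_tTransform_Iio ha hpos (not_ae_eq_zero hμ))
  have hlim := lt_of_strictAntiOn_of_tendsto_nhdsLT hanti hTa hz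
  have hlt : 1 / θ < tTransform μ z := EReal.coe_lt_coe_iff.1 (hTaθ.trans_lt hlim)
  rwa [div_lt_iff_of_neg' hθ] at hlt

end Subcritical

/-! ### Overlap of an eigenvector with the perturbation -/

section SecularEq

open Matrix

variable {𝕜 : Type*} [RCLike 𝕜]

/-- The equation `A (1 + θ v v*) u = y u` in the coordinates of an eigenbasis of `A` with
eigenvalues `x`. -/
def SecularEq {ι : Type*} [Fintype ι] (θ : ℝ) (x : ι → ℝ) (v u : ι → 𝕜) (y : ℝ) : Prop :=
  ∀ i, ((y - x i : ℝ) : 𝕜) * u i = ((θ * x i : ℝ) : 𝕜) * (star v ⬝ᵥ u) * v i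

section IsUnitEigenvector

variable {n : ℕ} {z : ℝ} {u : EuclideanSpace 𝕜 (Fin n)}

lemma IsUnitEigenvector.secularEq {A : Matrix (Fin n) (Fin n) 𝕜} {θ : ℝ} {v : Fin n → 𝕜}
    (hu : IsUnitEigenvector (A * (1 + rankOneMatrix θ v)) z u) (hA : A.IsHermitian) :
    SecularEq θ hA.eigenvalues (eigenCoord hA v) (eigenCoord hA u.ofLp) z := fun i => by
  have heig : (A * (1 + rankOneMatrix θ v)) *ᵥ u.ofLp = (z : 𝕜) • u.ofLp :=
    congrArg WithLp.ofLp hu.2.apply_eq_smul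
  have hcoord := congrArg (fun w => eigenCoord hA w i) heig
  simp only [← mulVec_mulVec, add_mulVec, one_mulVec, rankOneMatrix_mulVec, eigenCoord_mulVec,
    map_add, map_smul, Pi.add_apply, Pi.smul_apply, smul_eq_mul] at hcoord
  rw [star_dotProduct_eigenCoord]
  push_cast
  linear_combination -hcoord

lemma IsUnitEigenvector.sum_norm_sq_eq_one {B : Matrix (Fin n) (Fin n) 𝕜}
    (hu : IsUnitEigenvector B z u) : ∑ i, ‖u.ofLp i‖ ^ 2 = 1 := by
  rw [← EuclideanSpace.norm_sq_eq, hu.1, one_pow]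

end IsUnitEigenvector

namespace SecularEq

variable {ι : Type*} [Fintype ι] {θ y z : ℝ} {x : ι → ℝ} {v u : ι → 𝕜}

protected lemma neg (h : SecularEq θ x v u y) : SecularEq θ (-x) v u (-y) := fun i => by
  have hi := h i
  push_cast [Pi.neg_apply] at hi ⊢
  linear_combination -hi

lemma mul_sum_eq_one (h : SecularEq θ x v u y) (hy : ∀ i, y ≠ x i) (hc : star v ⬝ᵥ u ≠ 0) :
    θ * ∑ i, ‖v i‖ ^ 2 * (x i / (y - x i)) = 1 := by
  have hterm : ∀ i, star (v i) * u i =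
      (star v ⬝ᵥ u) * ((θ * (‖v i‖ ^ 2 * (x i / (y - x i))) : ℝ) : 𝕜) := fun i => by
    have hne : ((y - x i : ℝ) : 𝕜) ≠ 0 := RCLike.ofReal_ne_zero.2 (sub_ne_zero.2 (hy i))
    have hnorm : star (v i) * v i = (‖v i‖ : 𝕜) ^ 2 := RCLike.conj_mul _
    refine mul_left_cancel₀ hne ?_
    rw [mul_left_comm, h i]
    push_cast at hne ⊢
    field_simp
    linear_combination (θ : 𝕜) * (x i : 𝕜) * hnorm
  have hsum : (star v ⬝ᵥ u) * ((θ * ∑ i, ‖v i‖ ^ 2 * (x i / (y - x i)) : ℝ) : 𝕜) =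
      (star v ⬝ᵥ u) * 1 := by
    rw [Finset.mul_sum, RCLike.ofReal_sum, Finset.mul_sum, mul_one]
    exact (Finset.sum_congr rfl fun i _ => hterm i).symm
  exact_mod_cast mul_left_cancel₀ hc hsum

lemma lt_of_mul_sum_lt_one (h : SecularEq θ x v u y) (hc : star v ⬝ᵥ u ≠ 0)
    (hθx : ∀ i, 0 ≤ θ * x i) (hxz : ∀ i, x i < z)
    (hz : θ * ∑ i, ‖v i‖ ^ 2 * (x i / (z - x i)) < 1) : y < z := by
  by_contra! hzy
  refine hz.not_ge ?_
  rw [← h.mul_sum_eq_one (fun i => ((hxz i).trans_le hzy).ne') hc, Finset.mul_sum, Finset.mul_sum]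
  refine Finset.sum_le_sum fun i _ => ?_
  have hcomm : ∀ d, θ * (‖v i‖ ^ 2 * (x i / d)) = ‖v i‖ ^ 2 * (θ * x i / d) := fun d => by ring
  rw [hcomm, hcomm]
  have := sub_pos.2 (hxz i)
  gcongr
  exact hθx i

lemma mul_sum_sq_le (h : SecularEq θ x v u y) (hz : ∀ i, |y - x i| ≤ z - x i) :
    θ ^ 2 * ‖star v ⬝ᵥ u‖ ^ 2 * ∑ i, ‖v i‖ ^ 2 * (x i / (z - x i)) ^ 2 ≤ ∑ i, ‖u i‖ ^ 2 := by
  rw [Finset.mul_sum]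
  refine Finset.sum_le_sum fun i _ => ?_
  have hnorm : |y - x i| * ‖u i‖ = |θ * x i| * ‖star v ⬝ᵥ u‖ * ‖v i‖ := by
    simpa only [norm_mul, RCLike.norm_ofReal] using congrArg norm (h i)
  calc θ ^ 2 * ‖star v ⬝ᵥ u‖ ^ 2 * (‖v i‖ ^ 2 * (x i / (z - x i)) ^ 2)
      = (|θ * x i| * ‖star v ⬝ᵥ u‖ * ‖v i‖) ^ 2 / (z - x i) ^ 2 := by
        rw [mul_pow, mul_pow, sq_abs, div_pow]
        ring
    _ = (|y - x i| * ‖u i‖) ^ 2 / (z - x i) ^ 2 := by rw [hnorm]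
    _ ≤ ‖u i‖ ^ 2 := by
      refine div_le_of_le_mul₀ (sq_nonneg _) (sq_nonneg _) ?_
      rw [← mul_pow, mul_comm ‖u i‖]
      gcongr
      exact hz i

/-- For `-1 < θ` the factor is less than `1`, so the coordinates with `x i` close to zero carry a
fixed share of the overlap. -/
lemma norm_star_mul_le (h : SecularEq θ x v u y) (hθ : θ < 0) {i : ι} (hx : 0 < x i)
    (hy : y ≤ (1 + θ) / 2 * x i) :
    ‖star (v i) * u i‖ ≤ -(2 * θ) / (1 - θ) * ‖star v ⬝ᵥ u‖ * ‖v i‖ ^ 2 := by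
  have hgap : (1 - θ) / 2 * x i ≤ |y - x i| := by
    rw [abs_sub_comm]
    exact le_trans (by linarith) (le_abs_self _)
  have hnorm : |y - x i| * ‖u i‖ = -θ * x i * ‖star v ⬝ᵥ u‖ * ‖v i‖ := by
    have := congrArg norm (h i)
    rwa [norm_mul, norm_mul, norm_mul, RCLike.norm_ofReal, RCLike.norm_ofReal, abs_mul,
      abs_of_neg hθ, abs_of_pos hx] at this
  have hu : ‖u i‖ ≤ -(2 * θ) / (1 - θ) * ‖star v ⬝ᵥ u‖ * ‖v i‖ := by
    rw [mul_assoc, div_mul_eq_mul_div, le_div_iff₀ (by linarith)]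
    refine le_of_mul_le_mul_left ?_ hx
    linarith [mul_le_mul_of_nonneg_right hgap (norm_nonneg (u i))]
  calc ‖star (v i) * u i‖ = ‖v i‖ * ‖u i‖ := by rw [norm_mul, norm_star]
    _ ≤ ‖v i‖ * (-(2 * θ) / (1 - θ) * ‖star v ⬝ᵥ u‖ * ‖v i‖) := by gcongr
    _ = _ := by ring

end SecularEq

lemma norm_sum_star_mul_sq_le {ι : Type*} (s : Finset ι) (v u : ι → 𝕜) :
    ‖∑ i ∈ s, star (v i) * u i‖ ^ 2 ≤ (∑ i ∈ s, ‖v i‖ ^ 2) * ∑ i ∈ s, ‖u i‖ ^ 2 :=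
  calc _ ≤ (∑ i ∈ s, ‖v i‖ * ‖u i‖) ^ 2 := by
        gcongr
        exact norm_sum_le_of_le _ fun i _ => by rw [norm_mul, norm_star]
    _ ≤ _ := Finset.sum_mul_sq_le_sq_mul_sq _ _ _

lemma SecularEq.mul_norm_sq_le_sum_filter {ι : Type*} [Fintype ι] {θ y δ : ℝ} {x : ι → ℝ}
    {v u : ι → 𝕜} (h : SecularEq θ x v u y) (hθ : θ < 0) (hθ1 : -1 < θ) (hδ : 0 < δ)
    (hy : y ≤ (1 + θ) / 2 * δ) (hu : ∑ i, ‖u i‖ ^ 2 = 1) (hv : ∑ i, ‖v i‖ ^ 2 = 1) :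
    ((1 + θ) / (1 - θ)) ^ 2 * ‖star v ⬝ᵥ u‖ ^ 2 ≤ ∑ i with x i ≤ δ, ‖v i‖ ^ 2 := by
  have hκ : 0 ≤ -(2 * θ) / (1 - θ) := div_nonneg (by linarith) (by linarith)
  have hfar : ‖∑ i with ¬ x i ≤ δ, star (v i) * u i‖ ≤
      -(2 * θ) / (1 - θ) * ‖star v ⬝ᵥ u‖ := by
    calc _ ≤ ∑ i with ¬ x i ≤ δ, -(2 * θ) / (1 - θ) * ‖star v ⬝ᵥ u‖ * ‖v i‖ ^ 2 := by
          refine norm_sum_le_of_le _ fun i hi => ?_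
          have hδx : δ < x i := not_le.1 (Finset.mem_filter.1 hi).2
          exact h.norm_star_mul_le hθ (hδ.trans hδx) (hy.trans (by gcongr; linarith))
      _ ≤ ∑ i, -(2 * θ) / (1 - θ) * ‖star v ⬝ᵥ u‖ * ‖v i‖ ^ 2 :=
          Finset.sum_le_univ_sum_of_nonneg fun i => by positivity
      _ = _ := by rw [← Finset.mul_sum, hv, mul_one]
  have hnear : ‖∑ i with x i ≤ δ, star (v i) * u i‖ ^ 2 ≤ ∑ i with x i ≤ δ, ‖v i‖ ^ 2 := by
    refine (norm_sum_star_mul_sq_le _ v u).trans (mul_le_of_le_one_right (by positivity) ?_)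
    rw [← hu]
    exact Finset.sum_le_univ_sum_of_nonneg fun i => sq_nonneg _
  have htriangle : ‖star v ⬝ᵥ u‖ ≤ ‖∑ i with x i ≤ δ, star (v i) * u i‖ +
      ‖∑ i with ¬ x i ≤ δ, star (v i) * u i‖ := by
    refine le_of_eq_of_le (congrArg norm ?_) (norm_add_le _ _)
    exact (Finset.sum_filter_add_sum_filter_not _ _ _).symm
  refine le_trans ?_ hnear
  rw [← mul_pow]
  refine pow_le_pow_left₀ (mul_nonneg (div_nonneg ?_ ?_) (norm_nonneg _)) ?_ 2
  · linarith
  · linarith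
  · have hne : 1 - θ ≠ 0 := by linarith
    have hsplit : (1 + θ) / (1 - θ) = 1 - -(2 * θ) / (1 - θ) := by
      field_simp
      ring
    rw [hsplit]
    linarith

end SecularEq

section WeightedLimits

variable {κ : Type*} {l : Filter κ} {ι : κ → Type*} [∀ k, Fintype (ι k)]
  {w x : (k : κ) → ι k → ℝ} {μ : Measure ℝ}

/-- The function `t / (z - t)`, frozen to the right of `m < z` so as to be bounded. -/
noncomputable def truncatedKernel (m z : ℝ) (h : m < z) : BoundedContinuousFunction ℝ ℝ :=
  BoundedContinuousFunction.ofNormedAddCommGroup (fun t => min t m / (z - min t m))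
    (Continuous.div (by fun_prop) (by fun_prop) fun t => by linarith [min_le_right t m])
    (1 + |z| / (z - m)) fun t => abs_div_sub_le (sub_pos.2 h) <|
      (sub_le_sub_left (min_le_right t m) z).trans (le_abs_self _)

lemma truncatedKernel_apply_of_le {m z t : ℝ} (h : m < z) (ht : t ≤ m) :
    truncatedKernel m z h t = t / (z - t) := by
  simp [truncatedKernel, min_eq_left ht]

lemma tendsto_sum_mul_div_sub_pow {β z : ℝ}
    (hconv : ∀ f : BoundedContinuousFunction ℝ ℝ,
      Tendsto (fun k => ∑ i, w k i * f (x k i)) l (𝓝 (∫ t, f t ∂μ)))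
    (hβ : ∀ᵐ t ∂μ, t ≤ β) (hx : ∀ m > β, ∀ᶠ k in l, ∀ i, x k i ≤ m) (hz : β < z) (p : ℕ) :
    Tendsto (fun k => ∑ i, w k i * (x k i / (z - x k i)) ^ p) l
      (𝓝 (∫ t, (t / (z - t)) ^ p ∂μ)) := by
  obtain ⟨m, hβm, hmz⟩ := exists_between hz
  have hlim := hconv (truncatedKernel m z hmz ^ p)
  have hint : ∫ t, (truncatedKernel m z hmz ^ p) t ∂μ = ∫ t, (t / (z - t)) ^ p ∂μ :=
    integral_congr_ae (hβ.mono fun t ht =>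
      congrArg (· ^ p) (truncatedKernel_apply_of_le hmz (ht.trans hβm.le)))
  rw [hint] at hlim
  refine hlim.congr' ((hx m hβm).mono fun k hk => Finset.sum_congr rfl fun i _ => ?_)
  rw [BoundedContinuousFunction.pow_apply, truncatedKernel_apply_of_le hmz (hk i)]

/-- A continuous cutoff, for `δ > 0` equal to `1` on `(-∞, δ]` and to `0` on `[2 * δ, ∞)`. -/
noncomputable def leftCutoff (δ : ℝ) : BoundedContinuousFunction ℝ ℝ :=
  BoundedContinuousFunction.ofNormedAddCommGroup (fun t => max 0 (min 1 (2 - t / δ)))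
    (by fun_prop) 1 fun t => by
      rw [Real.norm_eq_abs, abs_of_nonneg (le_max_left _ _)]
      exact max_le zero_le_one (min_le_left _ _)

lemma leftCutoff_nonneg (δ t : ℝ) : 0 ≤ leftCutoff δ t := le_max_left _ _

lemma leftCutoff_le_one (δ t : ℝ) : leftCutoff δ t ≤ 1 := max_le zero_le_one (min_le_left _ _)

lemma one_le_leftCutoff {δ t : ℝ} (hδ : 0 < δ) (ht : t ≤ δ) : 1 ≤ leftCutoff δ t :=
  le_max_of_le_right (le_min le_rfl (by linarith [(div_le_one hδ).2 ht]))

lemma leftCutoff_eq_zero {δ t : ℝ} (hδ : 0 < δ) (ht : 2 * δ ≤ t) : leftCutoff δ t = 0 :=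
  max_eq_left ((min_le_right _ _).trans (sub_nonpos.2 ((le_div_iff₀ hδ).2 ht)))

lemma tendsto_integral_leftCutoff [IsFiniteMeasure μ] (hpos : ∀ᵐ t ∂μ, 0 < t) :
    Tendsto (fun δ => ∫ t, leftCutoff δ t ∂μ) (𝓝[>] 0) (𝓝 0) := by
  suffices Tendsto (fun δ => ∫ t, leftCutoff δ t ∂μ) (𝓝[>] 0) (𝓝 (∫ _, (0 : ℝ) ∂μ)) by
    simpa only [integral_zero] using this
  refine tendsto_integral_filter_of_dominated_convergence (fun _ => 1)
    (.of_forall fun δ => (leftCutoff δ).continuous.aestronglyMeasurable)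
    (.of_forall fun δ => .of_forall fun t => ?_) (integrable_const _) ?_
  · rw [Real.norm_eq_abs, abs_of_nonneg (leftCutoff_nonneg δ t)]
    exact leftCutoff_le_one δ t
  · filter_upwards [hpos] with t ht
    refine tendsto_const_nhds.congr' ?_
    filter_upwards [Ioo_mem_nhdsGT (half_pos ht)] with δ hδ
    exact (leftCutoff_eq_zero hδ.1 (by linarith [hδ.2])).symm

lemma sum_filter_le_sum_mul_leftCutoff {J : Type*} [Fintype J] {ρ s : J → ℝ} {δ : ℝ}
    (hρ : ∀ j, 0 ≤ ρ j) (hδ : 0 < δ) :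
    ∑ j with s j ≤ δ, ρ j ≤ ∑ j, ρ j * leftCutoff δ (s j) := by
  rw [Finset.sum_filter]
  refine Finset.sum_le_sum fun j _ => ?_
  split_ifs with h
  · exact le_mul_of_one_le_right (hρ j) (one_le_leftCutoff hδ h)
  · exact mul_nonneg (hρ j) (leftCutoff_nonneg _ _)

end WeightedLimits

section EdgeOverlap

open Matrix

variable {𝕜 : Type*} [RCLike 𝕜] {κ : Type*} {l : Filter κ} {ι : κ → Type*}
  [∀ k, Fintype (ι k)] {x : (k : κ) → ι k → ℝ} {v u : (k : κ) → ι k → 𝕜} {y : κ → ℝ}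
  {μ : Measure ℝ} {θ β : ℝ}

lemma tendsto_norm_dotProduct_of_edge
    (hconv : ∀ f : BoundedContinuousFunction ℝ ℝ,
      Tendsto (fun k => ∑ i, ‖v k i‖ ^ 2 * f (x k i)) l (𝓝 (∫ t, f t ∂μ)))
    (heq : ∀ᶠ k in l, SecularEq θ (x k) (v k) (u k) (y k))
    (hu : ∀ᶠ k in l, ∑ i, ‖u k i‖ ^ 2 = 1) (hθ : θ ≠ 0) (hθx : ∀ᶠ k in l, ∀ i, 0 ≤ θ * x k i)
    (hβ : ∀ᵐ t ∂μ, t ≤ β) (hx : ∀ m > β, ∀ᶠ k in l, ∀ i, x k i ≤ m)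
    (hy : ∀ m < β, ∀ᶠ k in l, m ≤ y k) (hsub : ∀ z > β, θ * tTransform μ z < 1)
    (hdiv : ∀ K, ∃ z > β, K < ∫ t, (t / (z - t)) ^ 2 ∂μ) :
    Tendsto (fun k => ‖star (v k) ⬝ᵥ u k‖) l (𝓝 0) := by
  rw [Metric.tendsto_nhds]
  intro η hη
  obtain ⟨z, hz, hK⟩ := hdiv (1 / (θ ^ 2 * η ^ 2))
  have hfirst := (tendsto_sum_mul_div_sub_pow hconv hβ hx (left_lt_add_div_two.2 hz) 1).const_mul θ
  have hsecond := tendsto_sum_mul_div_sub_pow hconv hβ hx hz 2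
  simp only [pow_one] at hfirst
  filter_upwards [hfirst.eventually_lt_const (hsub _ (left_lt_add_div_two.2 hz)),
    hsecond.eventually_const_lt hK, hx (β + (z - β) / 4) (by linarith),
    hy (β - (z - β) / 4) (by linarith), heq, hu, hθx] with k hfirst hsecond hx hy heq hu hθx
  rw [dist_zero_right, norm_norm]
  by_contra! hle
  have hc : star (v k) ⬝ᵥ u k ≠ 0 := norm_pos_iff.1 (hη.trans_le hle)
  have hyz : y k < (β + z) / 2 :=
    heq.lt_of_mul_sum_lt_one hc hθx (fun i => (hx i).trans_lt (by linarith)) hfirst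
  have hbound := heq.mul_sum_sq_le (z := z) fun i => abs_le.2 ⟨by linarith [hx i], by linarith⟩
  rw [hu] at hbound
  refine hbound.not_gt ?_
  calc 1 < θ ^ 2 * η ^ 2 * ∑ i, ‖v k i‖ ^ 2 * (x k i / (z - x k i)) ^ 2 :=
        (div_lt_iff₀' (by positivity)).1 hsecond
    _ ≤ _ := by gcongr

lemma tendsto_norm_dotProduct_of_edge_zero [IsFiniteMeasure μ]
    (hconv : ∀ f : BoundedContinuousFunction ℝ ℝ,
      Tendsto (fun k => ∑ i, ‖v k i‖ ^ 2 * f (x k i)) l (𝓝 (∫ t, f t ∂μ)))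
    (heq : ∀ᶠ k in l, SecularEq θ (x k) (v k) (u k) (y k))
    (hu : ∀ᶠ k in l, ∑ i, ‖u k i‖ ^ 2 = 1) (hv : ∀ᶠ k in l, ∑ i, ‖v k i‖ ^ 2 = 1)
    (hθ : θ < 0) (hθ1 : -1 < θ) (hpos : ∀ᵐ t ∂μ, 0 < t) (hy : ∀ ε > 0, ∀ᶠ k in l, y k ≤ ε) :
    Tendsto (fun k => ‖star (v k) ⬝ᵥ u k‖) l (𝓝 0) := by
  rw [Metric.tendsto_nhds]
  intro η hη
  have hγ : 0 < (1 + θ) / (1 - θ) := div_pos (by linarith) (by linarith)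
  obtain ⟨δ, hlt, hδ⟩ := (((tendsto_integral_leftCutoff hpos).eventually_lt_const
    (show 0 < ((1 + θ) / (1 - θ)) ^ 2 * η ^ 2 by positivity)).and self_mem_nhdsWithin).exists
  filter_upwards [(hconv (leftCutoff δ)).eventually_lt_const hlt,
    hy ((1 + θ) / 2 * δ) (mul_pos (by linarith) hδ), heq, hu, hv] with k hlt hy heq hu hv
  have hbound := (heq.mul_norm_sq_le_sum_filter hθ hθ1 hδ hy hu hv).trans
    (sum_filter_le_sum_mul_leftCutoff (fun i => sq_nonneg ‖v k i‖) hδ)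
  rw [dist_zero_right, norm_norm]
  refine lt_of_pow_lt_pow_left₀ 2 hη.le ?_
  exact lt_of_mul_lt_mul_left (hbound.trans_lt hlt) (by positivity)

end EdgeOverlap

/-! ### Delocalisation of the extreme eigenvector -/

section ExtremeEigenvector

open Matrix

variable {𝕜 : Type*} [RCLike 𝕜] {X : (n : ℕ) → Matrix (Fin n) (Fin n) 𝕜}
  {v : (n : ℕ) → Fin n → 𝕜} {u : (n : ℕ) → EuclideanSpace 𝕜 (Fin n)}
  {μ : Measure ℝ} [IsProbabilityMeasure μ] {θ a b : ℝ}

section Edge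

variable (hX : ∀ n, (X n).PosSemidef)
  (hconv : ∀ f : BoundedContinuousFunction ℝ ℝ, Tendsto
    (fun n => ∑ i, ‖eigenCoord (hX n).isHermitian (v n) i‖ ^ 2 *
      f ((hX n).isHermitian.eigenvalues i)) atTop (𝓝 (∫ t, f t ∂μ)))

include hconv

lemma tendsto_norm_dotProduct_of_maxEigenvalue
    (hu : ∀ᶠ n in atTop, IsUnitEigenvector (X n * (1 + rankOneMatrix θ (v n)))
      (maxEigenvalue (X n * (1 + rankOneMatrix θ (v n)))) (u n))
    (hmax : Tendsto (fun n => maxEigenvalue (X n)) atTop (𝓝 b)) (hθ : 0 < θ)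
    (hb : ∀ᵐ t ∂μ, t ≤ b) (hb0 : b ≠ 0) (hsub : ∀ z > b, θ * tTransform μ z < 1)
    (hderiv : Tendsto (deriv (tTransform μ)) (𝓝[>] b) atBot) :
    Tendsto (fun n => ‖star (v n) ⬝ᵥ (u n).ofLp‖) atTop (𝓝 0) := by
  have hcoord := fun n => star_dotProduct_eigenCoord (hX n).isHermitian (v n) (u n).ofLp
  simp only [← hcoord]
  refine tendsto_norm_dotProduct_of_edge hconv
    (hu.mono fun n hn => hn.secularEq (hX n).isHermitian)
    (hu.mono fun n hn => (sum_norm_sq_eigenCoord _ _).trans hn.sum_norm_sq_eq_one) hθ.ne'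
    (.of_forall fun n i => mul_nonneg hθ.le ((hX n).eigenvalues_nonneg i)) hb
    (fun m hm => ?_) (fun m hm => ?_) hsub
    (exists_lt_integral_div_sub_sq hb hb0 (tendsto_abs_atBot_atTop.comp hderiv))
  · filter_upwards [hmax.eventually_le_const hm] with n hn i
    exact (le_maxEigenvalue (eigenvalues_mem_realEigenvalues _ i)).trans hn
  · filter_upwards [hmax.eventually_const_le hm, eventually_ne_atTop 0] with n hn hn0
    have : NeZero n := ⟨hn0⟩
    exact hn.trans (maxEigenvalue_le_mul_one_add_rankOneMatrix (hX n) hθ.le (v n))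

variable
  (hu : ∀ᶠ n in atTop, IsUnitEigenvector (X n * (1 + rankOneMatrix θ (v n)))
    (minEigenvalue (X n * (1 + rankOneMatrix θ (v n)))) (u n))
  (hmin : Tendsto (fun n => minEigenvalue (X n)) atTop (𝓝 a)) (hθ : θ < 0)

include hu hmin hθ

lemma tendsto_norm_dotProduct_of_minEigenvalue_of_ne_zero (ha : ∀ᵐ t ∂μ, a ≤ t) (ha0 : a ≠ 0)
    (hsub : ∀ z < a, θ * tTransform μ z < 1)
    (hderiv : Tendsto (deriv (tTransform μ)) (𝓝[<] a) atBot) :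
    Tendsto (fun n => ‖star (v n) ⬝ᵥ (u n).ofLp‖) atTop (𝓝 0) := by
  have : IsProbabilityMeasure (μ.map Neg.neg) :=
    Measure.isProbabilityMeasure_map measurable_neg.aemeasurable
  have hcoord := fun n => star_dotProduct_eigenCoord (hX n).isHermitian (v n) (u n).ofLp
  simp only [← hcoord]
  -- Reflecting the spectrum turns the lower edge `a` into the upper edge `-a`.
  refine tendsto_norm_dotProduct_of_edge (μ := μ.map Neg.neg) (β := -a) (fun f => ?_)
    (hu.mono fun n hn => (hn.secularEq (hX n).isHermitian).neg)
    (hu.mono fun n hn => (sum_norm_sq_eigenCoord _ _).trans hn.sum_norm_sq_eq_one) hθ.ne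
    (.of_forall fun n i => mul_nonneg_of_nonpos_of_nonpos hθ.le
      (neg_nonpos.2 ((hX n).eigenvalues_nonneg i))) (ae_map_neg_le ha)
    (fun m hm => ?_) (fun m hm => ?_)
    (fun z hz => by simpa only [tTransform_map_neg] using hsub (-z) (neg_lt.1 hz))
    (exists_lt_integral_div_sub_sq (ae_map_neg_le ha) (neg_ne_zero.2 ha0)
      (tendsto_abs_deriv_tTransform_map_neg hderiv))
  · rw [measurableEmbedding_neg.integral_map]
    exact hconv (f.compContinuous ⟨Neg.neg, continuous_neg⟩)
  · filter_upwards [hmin.eventually_const_le (neg_lt.1 hm)] with n hn i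
    exact neg_le.1 (hn.trans (minEigenvalue_le (eigenvalues_mem_realEigenvalues _ i)))
  · filter_upwards [hmin.eventually_le_const (lt_neg.1 hm), eventually_ne_atTop 0] with n hn hn0
    have : NeZero n := ⟨hn0⟩
    exact le_neg.1 ((minEigenvalue_mul_one_add_rankOneMatrix_le (hX n) hθ.le (v n)).trans hn)

lemma tendsto_norm_dotProduct_of_minEigenvalue_of_eq_zero
    (hv : ∀ᶠ n in atTop, ∑ i, ‖v n i‖ ^ 2 = 1) (hθ1 : -1 < θ) (ha0 : a = 0)
    (hpos : ∀ᵐ t ∂μ, 0 < t) :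
    Tendsto (fun n => ‖star (v n) ⬝ᵥ (u n).ofLp‖) atTop (𝓝 0) := by
  have hcoord := fun n => star_dotProduct_eigenCoord (hX n).isHermitian (v n) (u n).ofLp
  simp only [← hcoord]
  refine tendsto_norm_dotProduct_of_edge_zero hconv
    (hu.mono fun n hn => hn.secularEq (hX n).isHermitian)
    (hu.mono fun n hn => (sum_norm_sq_eigenCoord _ _).trans hn.sum_norm_sq_eq_one)
    (hv.mono fun n hn => (sum_norm_sq_eigenCoord _ _).trans hn) hθ hθ1 hpos fun ε hε => ?_
  filter_upwards [hmin.eventually_le_const (ha0.trans_lt hε), eventually_ne_atTop 0]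
    with n hn hn0
  have : NeZero n := ⟨hn0⟩
  exact (minEigenvalue_mul_one_add_rankOneMatrix_le (hX n) hθ.le (v n)).trans hn

end Edge

variable {Ta Tb : EReal}

lemma tendsto_projNorm_of_extremeEigenvalue (hX : ∀ n, (X n).PosSemidef)
    (hv : ∀ᶠ n in atTop, ∑ i, ‖v n i‖ ^ 2 = 1) (hθ : θ ≠ 0) (hθ1 : -1 < θ)
    (hμ : μ ≠ Measure.dirac 0) (ha : ∀ᵐ t ∂μ, a ≤ t) (hb : ∀ᵐ t ∂μ, t ≤ b)
    (hdev : ∀ k, Tendsto (fun n => traceDeviation θ (X n ^ k) (rankOneMatrix θ (v n))) atTop (𝓝 0))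
    (hweak : WeaklyConverges (fun n => empiricalSpectralMeasure (hX n).isHermitian) μ)
    (hmin : Tendsto (fun n => minEigenvalue (X n)) atTop (𝓝 a))
    (hmax : Tendsto (fun n => maxEigenvalue (X n)) atTop (𝓝 b))
    (hTa : Tendsto (fun z => (tTransform μ z : EReal)) (𝓝[<] a) (𝓝 Ta))
    (hTb : Tendsto (fun z => (tTransform μ z : EReal)) (𝓝[>] b) (𝓝 Tb))
    (hsub : ((1 / θ : ℝ) : EReal) ∉ Set.Ioo Ta Tb)
    (hderivb : 0 < θ → Tendsto (deriv (tTransform μ)) (𝓝[>] b) atBot)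
    (hderiva : θ < 0 → Tendsto (deriv (tTransform μ)) (𝓝[<] a) atBot)
    (hatom : θ < 0 → μ {0} = 0)
    (hu : ∀ᶠ n in atTop, IsUnitEigenvector (X n * (1 + rankOneMatrix θ (v n)))
      (if 0 < θ then maxEigenvalue (X n * (1 + rankOneMatrix θ (v n)))
        else minEigenvalue (X n * (1 + rankOneMatrix θ (v n)))) (u n)) :
    Tendsto (fun n => projNorm (u n) (kerShift θ (rankOneMatrix θ (v n)))) atTop (𝓝 0) := by
  refine Tendsto.congr' (hv.mono fun n hn =>
    (projNorm_kerShift_rankOneMatrix hθ hn (u n)).symm) ?_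
  have ha0 : 0 ≤ a := ge_of_tendsto' hmin fun n =>
    Real.sInf_nonneg fun t ht => nonneg_of_mem_realEigenvalues (hX n) ht
  have hpos : ∀ᵐ t ∂μ, 0 ≤ t := ha.mono fun t ht => ha0.trans ht
  have hbound : ∀ᶠ n in atTop, ∀ i, |(hX n).isHermitian.eigenvalues i| ≤ b + 1 := by
    filter_upwards [hmax.eventually_le_const (lt_add_one b)] with n hn i
    rw [abs_of_nonneg ((hX n).eigenvalues_nonneg i)]
    exact (le_maxEigenvalue (eigenvalues_mem_realEigenvalues _ i)).trans hn
  have hconv := tendsto_sum_mul_integral (fun n => (hX n).isHermitian) hθ hv hbound hdev hweak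
  rcases hθ.lt_or_gt with hneg | hθpos
  · simp only [if_neg hneg.not_gt] at hu
    rcases eq_or_ne a 0 with ha0 | ha0
    · have hne : ∀ᵐ t ∂μ, t ≠ 0 := measure_eq_zero_iff_ae_notMem.1 (hatom hneg)
      exact tendsto_norm_dotProduct_of_minEigenvalue_of_eq_zero hX hconv hu hmin hneg hv hθ1 ha0
        (hpos.mp (hne.mono fun t hne hpos => hpos.lt_of_ne' hne))
    · exact tendsto_norm_dotProduct_of_minEigenvalue_of_ne_zero hX hconv hu hmin hneg ha ha0
        (fun z hz => mul_tTransform_lt_one_of_neg ha hb hpos hμ hTa hTb hsub hneg hz)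
        (hderiva hneg)
  · simp only [if_pos hθpos] at hu
    have hb0 : b ≠ 0 := fun hb0 => not_ae_eq_zero hμ <| by
      filter_upwards [hb, hpos] with t hle hge using le_antisymm (hle.trans_eq hb0) hge
    exact tendsto_norm_dotProduct_of_maxEigenvalue hX hconv hu hmax hθpos hb hb0
      (fun z hz => mul_tTransform_lt_one_of_pos ha hb hpos hμ hTa hTb hsub hθpos hz)
      (hderivb hθpos)

end ExtremeEigenvector

theorem theorem2p8
    {𝕜 : Type*} [RCLike 𝕜]
    {Ω : Type*} [MeasurableSpace Ω] (Pr : Measure Ω) [IsProbabilityMeasure Pr]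
    -- the random matrices
    (X P : (n : ℕ) → Ω → Matrix (Fin n) (Fin n) 𝕜)
    (hXmeas : ∀ n, Measurable (X n)) (hPmeas : ∀ n, Measurable (P n))
    (hX : ∀ n ω, (X n ω).PosSemidef)
    -- `P n` is Hermitian of rank one with sole nonzero eigenvalue `θ`
    (θ : ℝ) (hθ : θ ≠ 0)
    (hP : ∀ n ω, (P n ω).IsHermitian)
    (hPrank : ∀ n, 1 ≤ n → ∀ ω, (P n ω).rank = 1)
    (hPeig : ∀ n, 1 ≤ n → ∀ ω, θ ∈ realEigenvalues (P n ω))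
    (hindep : ∀ n, IndepFun (X n) (P n) Pr)
    (hinv : ∀ n, ConjInvariant Pr (X n) ∨ ConjInvariant Pr (P n))
    -- the limiting eigenvalue distribution
    (μX : Measure ℝ) [IsProbabilityMeasure μX] (hcompact : IsCompact μX.support)
    (hμX : μX ≠ Measure.dirac 0)
    (a b : ℝ) (ha : IsLeast μX.support a) (hb : IsGreatest μX.support b)
    (hweak : ∀ᵐ ω ∂Pr, WeaklyConverges (fun n => empiricalSpectralMeasure (hX n ω).isHermitian) μX)
    (hmin : ∀ᵐ ω ∂Pr, Tendsto (fun n => minEigenvalue (X n ω)) atTop (𝓝 a))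
    (hmax : ∀ᵐ ω ∂Pr, Tendsto (fun n => maxEigenvalue (X n ω)) atTop (𝓝 b))
    -- the one-sided limits `T(a⁻)` and `T(b⁺)`, possibly infinite
    (Ta Tb : EReal)
    (hTa : Tendsto (fun z => (tTransform μX z : EReal)) (𝓝[<] a) (𝓝 Ta))
    (hTb : Tendsto (fun z => (tTransform μX z : EReal)) (𝓝[>] b) (𝓝 Tb))
    -- subcritical perturbation, and infinite derivative at the relevant edge
    (hsub : ((1 / θ : ℝ) : EReal) ∉ Set.Ioo Ta Tb)
    (hderivb : 0 < θ → Tendsto (deriv (tTransform μX)) (𝓝[>] b) atBot)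
    (hderiva : θ < 0 → Tendsto (deriv (tTransform μX)) (𝓝[<] a) atBot)
    -- `I + P n` is positive definite, and for `θ < 0` the limit has no atom at zero
    (hθ1 : -1 < θ) (hatom : θ < 0 → μX {0} = 0) :
    ∀ᵐ ω ∂Pr, ∀ u : (n : ℕ) → EuclideanSpace 𝕜 (Fin n),
      (∀ n, 1 ≤ n → IsUnitEigenvector (X n ω * (1 + P n ω))
        (if 0 < θ then maxEigenvalue (X n ω * (1 + P n ω))
          else minEigenvalue (X n ω * (1 + P n ω))) (u n)) →
      Tendsto (fun n => projNorm (u n) (kerShift θ (P n ω))) atTop (𝓝 0) := by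
  have hPv : ∀ n, 1 ≤ n → ∀ ω, ∃ v, ∑ i, ‖v i‖ ^ 2 = 1 ∧ P n ω = rankOneMatrix θ v :=
    fun n hn ω => exists_eq_rankOneMatrix (hP n ω) (hPrank n hn ω) hθ (hPeig n hn ω)
  have hsupp : ∀ᵐ t ∂μX, t ∈ μX.support := Measure.support_mem_ae
  filter_upwards [hweak, hmin, hmax, ae_tendsto_traceDeviation_pow hXmeas hPmeas hindep hinv
    (fun n ω => (hX n ω).isHermitian) hθ hPv] with ω hweak hmin hmax hdev u hu
  have hPω : ∀ n, 1 ≤ n → ∃ v, ∑ i, ‖v i‖ ^ 2 = 1 ∧ P n ω = rankOneMatrix θ v :=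
    fun n hn => hPv n hn ω
  choose! v hv using hPω
  have hnorm : ∀ᶠ n in atTop, ∑ i, ‖v n i‖ ^ 2 = 1 :=
    (eventually_ge_atTop 1).mono fun n hn => (hv n hn).1
  have hrep : ∀ᶠ n in atTop, P n ω = rankOneMatrix θ (v n) :=
    (eventually_ge_atTop 1).mono fun n hn => (hv n hn).2
  have hlim := tendsto_projNorm_of_extremeEigenvalue (fun n => hX n ω) hnorm hθ hθ1 hμX
    (hsupp.mono fun t ht => ha.2 ht) (hsupp.mono fun t ht => hb.2 ht)
    (fun k => (hdev k).congr' (hrep.mono fun n hn => by rw [hn])) hweak hmin hmax hTa hTb hsub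
    hderivb hderiva hatom
    (by filter_upwards [hrep, eventually_ge_atTop 1] with n hrep hn using hrep ▸ hu n hn)
  exact hlim.congr' (hrep.mono fun n hn => congrArg (projNorm (u n) <| kerShift θ ·) hn.symm)
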